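/- **Conventions.** Let $m\ge 1$, $d=2^m$. For $a=(a^z;a^x)\in\mathbb F_2^{2m}$ let $P(a)=\bigotimes_{k=1}^m(-i)^{a^z_ka^x_k}Z^{a^z_k}X^{a^x_k}$ be the Pauli operator on $(\mathbb C^2)^{\otimes m}$. A *Pauli partition* is a partition of the $d^2-1$ non-identity Pauli operators into $d+1$ classes of $d-1$ pairwise commuting operators (the scheme of Bandyopadhyay et al.); it gives a set of $d+1$ orthonormal bases, the $j$-th basis consisting of common eigenvectors of the $j$-th class. A set of bases $\mathcal B_0,\dots,\mathcal B_d$ (as unitary matrices of columns) is a complete set of MUBs if any two different ones satisfy $|\langle\psi,\psi'\rangle|^2=1/d$ for all their vectors. It is cyclic if the bases are the columns of $U,U^2,\dots,U^{d+1}=1$ for a unitary $U$. Two complete sets are equivalent if $\mathcal B'_j=U\mathcal B_{\pi(j)}W_j$ for all $j$, with a unitary $U$, a permutation $\pi$ of the indices and unitary monomial matrices $W_j$. In a class, a set $S$ of qubits is *unentangled with the rest* if the restrictions of the operators of the class to $S$ commute. Two qubits lie in the same block if no such $S$ contains exactly one of them; the sizes of the blocks form a partition of $m$, the entanglement structure of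 the class (of its basis). The class (basis) is *completely factorizable* if all blocks have size $1$. The *entanglement vector* of a Pauli partition counts, for every partition of $m$, the classes having that structure. The Fibonacci polynomials are $F_0=0$, $F_1=1$, $F_{j+1}=xF_j+F_{j-1}$; the Fibonacci index of an irreducible $p\in\mathbb F_2[x]$ is the least $n\ge1$ with $p\mid F_n$. A triple $(A,R,B)$ of $m\times m$ matrices over $\mathbb F_2$ is *admissible* if $R,B$ are invertible, $A,R,BR$ are symmetric, and the characteristic polynomial of $B$ is irreducible of Fibonacci index $d+1$. A matrix $C\in M_{2m}(\mathbb F_2)$ defines the classes $\{P(C^jG_0c): c\in\mathbb F_2^m\}$ (here with the identity included), $0\le j\le d$, where $G_0=\binom{1_m}{0_m}$. The *semigroup-based* sets are those defined by $$C=\begin{pmatrix}B+AR^{-1}&R+BA+AR^{-1}A\\R^{-1}&R^{-1}A\end{pmatrix}$$ with $(A,R,B)$ admissible; the *field-based* sets are those defined by $\begin{pmatrix}B&1\\1&0\end{pmatrix}$ with $(0,1,B)$ admissible, that is, with $B$ symmetric and invertible and with irreducible characteristic polynomial of Fibonacci index $d+1$. **Theorem (Completeness of the construction scheme).** For every $m\ge1$: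 1. There is a matrix $B$ such that $(0,1,B)$ is admissible. For every admissible $(A,R,B)$, the classes defined by $C$ form a Pauli partition, and every choice of orthonormal bases of common eigenvectors of these classes is a complete set of MUBs. Moreover there is a unitary $U$ with $U^{d+1}=1$ which implements $C$, i.e. $UP(a)U^\dagger$ is a multiple of $P(Ca)$ for all $a$, such that the columns of $U^j$ form a basis of common eigenvectors of the $j$-th class for $0\le j\le d$; so the set is cyclic. 2. The entanglement vectors of the semigroup-based sets are exactly the entanglement vectors of those Pauli partitions which have at least one completely factorizable class and whose set of bases is equivalent to a field-based set. 3. Every semigroup-based set is equivalent to every field-based set. -/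

import Mathlib

open scoped Matrix

noncomputable section

namespace CyclicMUB

/-! ### Fibonacci polynomials -/

/-- The Fibonacci polynomials `F 0 = 0`, `F 1 = 1`, `F (j + 2) = x * F (j + 1) + F j`. -/
def fibPoly (K : Type*) [Field K] : ℕ → Polynomial K
  | 0 => 0
  | 1 => 1
  | (j + 2) => Polynomial.X * fibPoly K (j + 1) + fibPoly K j

/-- `p` is irreducible and its Fibonacci index, the least positive `n` such that `p` divides the
`n`-th Fibonacci polynomial, exists and equals `n`. -/
def HasFibonacciIndex {K : Type*} [Field K] (p : Polynomial K) (n : ℕ) : Prop :=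
  Irreducible p ∧ IsLeast {k : ℕ | 0 < k ∧ p ∣ fibPoly K k} n

/-! ### Operators and bases of the `m`-qubit space

The Hilbert space has the canonical basis indexed by `Fin m → ZMod 2`, so its dimension is
`2 ^ m`. A basis is identified with the matrix whose columns are its vectors. -/

/-- Complex matrices acting on `m` qubits. -/
abbrev QMat (m : ℕ) : Type := Matrix (Fin m → ZMod 2) (Fin m → ZMod 2) ℂ

/-- Two bases (as matrices of columns) are mutually unbiased:
`|⟨u_k, v_l⟩|² = 1 / 2 ^ m` for all columns `u_k`, `v_l`. -/
def MutuallyUnbiased {m : ℕ} (U V : QMat m) : Prop :=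
  ∀ k l, ‖(Uᴴ * V) k l‖ ^ 2 = 1 / (2 : ℝ) ^ m

/-- A family of `2 ^ m + 1` orthonormal bases, pairwise mutually unbiased. -/
def IsCompleteMUB {m : ℕ} (𝓑 : Fin (2 ^ m + 1) → QMat m) : Prop :=
  (∀ j, 𝓑 j ∈ Matrix.unitaryGroup (Fin m → ZMod 2) ℂ) ∧
    Pairwise fun j k => MutuallyUnbiased (𝓑 j) (𝓑 k)

/-- A complete set of mutually unbiased bases is cyclic if its bases are, in some order, given by
the columns of `U, U ^ 2, …, U ^ (2 ^ m + 1) = 1` for a unitary `U`. -/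
def IsCyclicMUB {m : ℕ} (𝓑 : Fin (2 ^ m + 1) → QMat m) : Prop :=
  IsCompleteMUB 𝓑 ∧
    ∃ U ∈ Matrix.unitaryGroup (Fin m → ZMod 2) ℂ, U ^ (2 ^ m + 1) = 1 ∧
      ∃ π : Equiv.Perm (Fin (2 ^ m + 1)), ∀ j : Fin (2 ^ m + 1),
        ∃ τ : Equiv.Perm (Fin m → ZMod 2), 𝓑 (π j) = (U ^ ((j : ℕ) + 1)).submatrix id τ

/-- Unitary monomial matrices: a diagonal matrix of phases times a permutation matrix. -/
def IsMonomial {m : ℕ} (W : QMat m) : Prop :=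
  ∃ c : (Fin m → ZMod 2) → ℂ, (∀ i, ‖c i‖ = 1) ∧
    ∃ τ : Equiv.Perm (Fin m → ZMod 2), W = Matrix.diagonal c * τ.permMatrix ℂ

/-- Equivalence of complete sets of mutually unbiased bases: `𝓑' j = U * 𝓑 (π j) * W j`. -/
def MUBEquivalent {m : ℕ} (𝓑 𝓑' : Fin (2 ^ m + 1) → QMat m) : Prop :=
  ∃ U ∈ Matrix.unitaryGroup (Fin m → ZMod 2) ℂ, ∃ π : Equiv.Perm (Fin (2 ^ m + 1)),
    ∃ W : Fin (2 ^ m + 1) → QMat m, (∀ j, IsMonomial (W j)) ∧ ∀ j, 𝓑' j = U * 𝓑 (π j) * W j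

/-! ### Pauli operators -/

/-- Exponent vectors `(a^z ; a^x)` of Pauli operators on `m` qubits. -/
abbrev PVec (m : ℕ) : Type := Fin m ⊕ Fin m → ZMod 2

/-- `Z |i⟩ = (-1)^i |i⟩`. -/
def pauliZ : Matrix (ZMod 2) (ZMod 2) ℂ := Matrix.diagonal fun i => (-1 : ℂ) ^ i.val

/-- `X |i⟩ = |i + 1⟩`. -/
def pauliX : Matrix (ZMod 2) (ZMod 2) ℂ := Matrix.of fun k i => if k = i + 1 then 1 else 0

/-- The Pauli operator `(-i)^(a_1^z a_1^x) Z^(a_1^z) X^(a_1^x) ⊗ ⋯ ⊗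
(-i)^(a_m^z a_m^x) Z^(a_m^z) X^(a_m^x)`. -/
def pauli {m : ℕ} (a : PVec m) : QMat m :=
  Matrix.of fun x y => ∏ k : Fin m,
    ((-Complex.I) ^ ((a (Sum.inl k)).val * (a (Sum.inr k)).val) •
      (pauliZ ^ (a (Sum.inl k)).val * pauliX ^ (a (Sum.inr k)).val)) (x k) (y k)

/-- The scheme of Bandyopadhyay et al.: the non-identity Pauli operators are partitioned into
`2 ^ m + 1` classes of `2 ^ m - 1` commuting operators. Here `K j` is the `j`-th class together
with the identity. -/
structure IsPauliPartition {m : ℕ} (K : Fin (2 ^ m + 1) → Set (PVec m)) : Prop where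
  zero_mem : ∀ j, 0 ∈ K j
  card_eq : ∀ j, (K j).ncard = 2 ^ m
  existsUnique : ∀ a : PVec m, a ≠ 0 → ∃! j, a ∈ K j
  commute : ∀ j, ∀ a ∈ K j, ∀ b ∈ K j, Commute (pauli a) (pauli b)

/-- `𝓑 j` is an orthonormal basis of common eigenvectors of the `j`-th class, for every `j`. -/
def IsEigenbasisFamily {m : ℕ} (K : Fin (2 ^ m + 1) → Set (PVec m))
    (𝓑 : Fin (2 ^ m + 1) → QMat m) : Prop :=
  ∀ j, 𝓑 j ∈ Matrix.unitaryGroup (Fin m → ZMod 2) ℂ ∧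
    ∀ a ∈ K j, ((𝓑 j)ᴴ * pauli a * 𝓑 j).IsDiag

/-! ### Entanglement structure -/

/-- The part of a Pauli operator acting on the subsystems in `S`. -/
def restrictTo {m : ℕ} (S : Finset (Fin m)) (a : PVec m) : PVec m :=
  fun i => if Sum.elim id id i ∈ S then a i else 0

/-- The subsystem `S` is not entangled with the rest: the restrictions to `S` of the operators
of the class commute. -/
def IsSeparated {m : ℕ} (K : Set (PVec m)) (S : Finset (Fin m)) : Prop :=
  ∀ a ∈ K, ∀ b ∈ K, Commute (pauli (restrictTo S a)) (pauli (restrictTo S b))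

/-- Two qubits are related if no unentangled subsystem separates them. -/
def entanglementSetoid {m : ℕ} (K : Set (PVec m)) : Setoid (Fin m) where
  r i j := ∀ S, IsSeparated K S → (i ∈ S ↔ j ∈ S)
  iseqv :=
    { refl := fun _ _ _ => Iff.rfl
      symm := fun h S hS => (h S hS).symm
      trans := fun h₁ h₂ S hS => (h₁ S hS).trans (h₂ S hS) }

open scoped Classical in
/-- The partition of the set of qubits into the finest mutually unentangled blocks. -/
def entanglementBlocks {m : ℕ} (K : Set (PVec m)) :
    Finpartition (Finset.univ : Finset (Fin m)) :=
  Finpartition.ofSetoid (entanglementSetoid K)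

/-- The entanglement structure of a class: the partition of the number `m` given by the sizes of
the blocks. -/
def entanglementType {m : ℕ} (K : Set (PVec m)) : Nat.Partition m :=
  Nat.Partition.ofSums m ((entanglementBlocks K).parts.val.map Finset.card)
    ((entanglementBlocks K).sum_card_parts.trans (by simp))

/-- The partition `1 + ⋯ + 1` of `m`: completely factorizable. -/
def factorizable (m : ℕ) : Nat.Partition m :=
  Nat.Partition.ofSums m (Multiset.replicate m 1) (by simp)

open scoped Classical in
/-- The vector counting, for every partition of `m`, the bases having that entanglement
structure. -/
def entanglementVector {m : ℕ} (K : Fin (2 ^ m + 1) → Set (PVec m)) : Nat.Partition m → ℕ :=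
  fun μ => (Finset.univ.filter fun j => entanglementType (K j) = μ).card

/-! ### Stabilizer matrices -/

/-- `2m × 2m` matrices over the field with two elements, in `m × m` blocks. -/
abbrev SMat (m : ℕ) : Type := Matrix (Fin m ⊕ Fin m) (Fin m ⊕ Fin m) (ZMod 2)

/-- The generator `G₀ = (1 ; 0)`. -/
def genZero (m : ℕ) : Matrix (Fin m ⊕ Fin m) (Fin m) (ZMod 2) := Matrix.fromRows 1 0

/-- The classes `{G_j c : c}` with the generators `G_j = C ^ j G₀`, for `0 ≤ j ≤ 2 ^ m`. -/
def cyclicClasses {m : ℕ} (C : SMat m) : Fin (2 ^ m + 1) → Set (PVec m) :=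
  fun j => Set.range fun c : Fin m → ZMod 2 => (C ^ (j : ℕ) * genZero m) *ᵥ c

/-- The stabilizer matrix of field-based sets. -/
def fieldStabilizer {m : ℕ} (B : Matrix (Fin m) (Fin m) (ZMod 2)) : SMat m :=
  Matrix.fromBlocks B 1 1 0

/-- Admissible parameters of field-based sets. -/
structure IsFieldParam {m : ℕ} (B : Matrix (Fin m) (Fin m) (ZMod 2)) : Prop where
  isUnit : IsUnit B
  isSymm : B.IsSymm
  index : HasFibonacciIndex B.charpoly (2 ^ m + 1)

/-- The stabilizer matrix of semigroup-based sets. -/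
def semigroupStabilizer {m : ℕ} (A R B : Matrix (Fin m) (Fin m) (ZMod 2)) : SMat m :=
  Matrix.fromBlocks (B + A * R⁻¹) (R + B * A + A * R⁻¹ * A) R⁻¹ (R⁻¹ * A)

/-- Admissible parameters of semigroup-based sets. -/
structure IsSemigroupParam {m : ℕ} (A R B : Matrix (Fin m) (Fin m) (ZMod 2)) : Prop where
  isUnit_R : IsUnit R
  isUnit_B : IsUnit B
  isSymm_A : A.IsSymm
  isSymm_R : R.IsSymm
  isSymm_BR : (B * R).IsSymm
  index : HasFibonacciIndex B.charpoly (2 ^ m + 1)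

/-- The unitary `U` implements the stabilizer matrix `C`: conjugation by `U` maps the Pauli
operator of `a` to that of `C a`, up to a scalar. -/
def Implements {m : ℕ} (U : QMat m) (C : SMat m) : Prop :=
  ∀ a : PVec m, ∃ c : ℂ, U * pauli a * Uᴴ = c • pauli (C *ᵥ a)

/-- The class partition `K` has its complete set of mutually unbiased bases equivalent to a
field-based set. -/
def IsEquivalentToFieldBased {m : ℕ} (K : Fin (2 ^ m + 1) → Set (PVec m)) : Prop :=
  ∃ B : Matrix (Fin m) (Fin m) (ZMod 2), IsFieldParam B ∧
    ∃ 𝓑₀ 𝓑 : Fin (2 ^ m + 1) → QMat m,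
      IsEigenbasisFamily (cyclicClasses (fieldStabilizer B)) 𝓑₀ ∧
      IsEigenbasisFamily K 𝓑 ∧ MUBEquivalent 𝓑₀ 𝓑

end CyclicMUB

end

/-! Pauli operators multiply and commute according to a symplectic form on `F_2^{2m}`, so maximal
commuting classes are Lagrangian subspaces. Expanding projectors in Pauli operators shows that
eigenbases of two Lagrangians with zero intersection are mutually unbiased
(`mutuallyUnbiased_of_inter`).

In the coordinates `(x + A R⁻¹ y ; R⁻¹ y)` the matrix `C` acts by `(x, y) ↦ (B x + y, x)`, so `C ^
j` sends `(c ; 0)` to the vector with coordinates `(F_{j+1}(B) c, F_j(B) c)`. As the characteristic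
polynomial of `B` is irreducible, `F_2[B]` is a field, and `F_j(B)` is singular only if it is zero.
Fibonacci index `d + 1` thus makes the `d + 1` classes disjoint away from zero, and counting makes
them a partition (`IsSemigroupParam.isPauliPartition`). A Cassini identity gives `C ^ (d + 1) = 1`.
A unitary implementing `C` then has a scalar as its `(d + 1)`-th power, because `C` fixes no nonzero
vector. Admissible `B` come from `z + z⁻¹` with `z` of order `2 ^ m + 1` in the field of `4 ^ m`
elements, written in an orthonormal basis of the trace form.

Each class is an orbit, with zero added, of the field `F_2[B]` under an action that depends on
neither `R` nor the class. Hence `B` may be replaced by another admissible generator of that field.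
Since finite fields of equal size are isomorphic, a suitable `g(B)` is similar to any given `B₀`,
which yields a block triangular symplectic map between the two sets
(`IsSemigroupParam.exists_implementable`).

For the converse half of the statement on entanglement, a unitary that carries the bases of one
Pauli partition to those of another is a Clifford operator (`exists_conj_eq_smul_weyl`), so the
partitions are related by a symplectic map. Rotating by a power of `C` and applying a local
symplectic map, which preserves entanglement, turns a completely factorizable class into the `Z`
class. A symplectic map that preserves the `Z` class is block triangular, and such maps carry
field-based sets to semigroup-based ones (`IsFieldParam.conj`). -/

namespace CyclicMUB

/-! ### Signs and character sums -/

/-- The sign `(-1) ^ t` of an element of the field with two elements. -/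
def sgn (t : ZMod 2) : ℂ := (-1) ^ t.val

@[simp] lemma sgn_zero : sgn 0 = 1 := by simp [sgn]

@[simp] lemma sgn_one : sgn 1 = -1 := by simp [sgn, ZMod.val_one]

lemma zmod_two_cases (t : ZMod 2) : t = 0 ∨ t = 1 := by
  revert t; decide

lemma pi_add_self {ι : Type*} (x : ι → ZMod 2) : x + x = 0 :=
  funext fun _ => CharTwo.add_self_eq_zero _

lemma pi_eq_of_add_eq_zero {ι : Type*} {x y : ι → ZMod 2} (h : x + y = 0) : x = y :=
  funext fun k => CharTwo.add_eq_zero.1 (congrFun h k)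

lemma sum_pVec {m : ℕ} {M : Type*} [AddCommMonoid M] (f : PVec m → M) :
    ∑ a, f a = ∑ z, ∑ q, f (Sum.elim z q) := by
  rw [← (Equiv.sumArrowEquivProdArrow (Fin m) (Fin m) (ZMod 2)).symm.sum_comp,
    Fintype.sum_prod_type]
  rfl

lemma sgn_add (s t : ZMod 2) : sgn (s + t) = sgn s * sgn t := by
  have h : (1 + 1 : ZMod 2) = 0 := by decide
  rcases zmod_two_cases s with rfl | rfl <;> rcases zmod_two_cases t with rfl | rfl <;> simp [h]

lemma sgn_mul_self (t : ZMod 2) : sgn t * sgn t = 1 := by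
  rcases zmod_two_cases t with rfl | rfl <;> simp

@[simp] lemma star_sgn (t : ZMod 2) : star (sgn t) = sgn t := by
  rcases zmod_two_cases t with rfl | rfl <;> simp

lemma sgn_ne_zero (t : ZMod 2) : sgn t ≠ 0 := by
  rcases zmod_two_cases t with rfl | rfl <;> simp

lemma sgn_injective : Function.Injective sgn := by
  intro s t h
  rcases zmod_two_cases s with rfl | rfl <;> rcases zmod_two_cases t with rfl | rfl <;>
    first | rfl | (norm_num at h)

lemma sgn_sum {ι : Type*} (s : Finset ι) (f : ι → ZMod 2) :
    sgn (∑ k ∈ s, f k) = ∏ k ∈ s, sgn (f k) := by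
  classical
  induction s using Finset.induction_on with
  | empty => simp
  | insert a s ha ih => rw [Finset.sum_insert ha, Finset.prod_insert ha, sgn_add, ih]

lemma sum_sgn_dotProduct {ι : Type*} [Fintype ι] [DecidableEq ι] (x : ι → ZMod 2) :
    ∑ z : ι → ZMod 2, sgn (z ⬝ᵥ x) = if x = 0 then (2 : ℂ) ^ Fintype.card ι else 0 := by
  split_ifs with h
  · subst h
    simp [ZMod.card]
  · obtain ⟨k, hk⟩ := Function.ne_iff.1 h
    have hk1 : x k = 1 := (zmod_two_cases _).resolve_left hk
    -- Translation by the `k`-th unit vector permutes the index set and flips every sign, so the sum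
    -- equals its negative.
    have := Equiv.sum_comp (Equiv.addRight (Pi.single k (1 : ZMod 2) : ι → ZMod 2))
      fun z => sgn (z ⬝ᵥ x)
    simp only [Equiv.coe_addRight, add_dotProduct, sgn_add, single_one_dotProduct, hk1,
      sgn_one, mul_neg, mul_one, Finset.sum_neg_distrib] at this
    linear_combination (-1 / 2 : ℂ) * this

/-! ### The symplectic form -/

variable {m : ℕ}

/-- The exponent vector of the `Z` part. -/
abbrev zPart (a : PVec m) : Fin m → ZMod 2 := fun k => a (Sum.inl k)

/-- The exponent vector of the `X` part. -/
abbrev xPart (a : PVec m) : Fin m → ZMod 2 := fun k => a (Sum.inr k)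

lemma pVec_ext {a b : PVec m} (hz : zPart a = zPart b) (hx : xPart a = xPart b) : a = b := by
  funext i
  rcases i with k | k
  · exact congrFun hz k
  · exact congrFun hx k

/-- The standard symplectic form. -/
def sympl (a b : PVec m) : ZMod 2 := zPart a ⬝ᵥ xPart b + xPart a ⬝ᵥ zPart b

lemma sympl_comm (a b : PVec m) : sympl a b = sympl b a := by
  simp only [sympl, dotProduct_comm, add_comm]

lemma sympl_self (a : PVec m) : sympl a a = 0 := by
  simp only [sympl, dotProduct_comm, CharTwo.add_self_eq_zero]

lemma sympl_add_left (a b c : PVec m) : sympl (a + b) c = sympl a c + sympl b c := by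
  have hz : zPart (a + b) = zPart a + zPart b := rfl
  have hx : xPart (a + b) = xPart a + xPart b := rfl
  rw [sympl, hz, hx, add_dotProduct, add_dotProduct]
  simp only [sympl]
  ring

lemma sympl_add_right (a b c : PVec m) : sympl a (b + c) = sympl a b + sympl a c := by
  rw [sympl_comm, sympl_add_left, sympl_comm b, sympl_comm c]

@[simp] lemma sympl_zero_left (a : PVec m) : sympl 0 a = 0 := by
  simpa using sympl_add_left 0 0 a

@[simp] lemma sympl_zero_right (a : PVec m) : sympl a 0 = 0 := by
  rw [sympl_comm, sympl_zero_left]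

/-- The symplectic form as a bilinear form. -/
def symplForm (m : ℕ) : LinearMap.BilinForm (ZMod 2) (PVec m) :=
  LinearMap.mk₂ (ZMod 2) sympl sympl_add_left
    (fun c a b => by rcases zmod_two_cases c with rfl | rfl <;> simp)
    sympl_add_right
    (fun c a b => by rcases zmod_two_cases c with rfl | rfl <;> simp)

lemma eq_zero_of_sympl_eq_zero {a : PVec m} (h : ∀ b, sympl a b = 0) : a = 0 := by
  refine pVec_ext ?_ ?_ <;> funext k
  · simpa [sympl, dotProduct, Pi.single_apply] using h (Pi.single (Sum.inr k) 1)
  · simpa [sympl, dotProduct, Pi.single_apply] using h (Pi.single (Sum.inl k) 1)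

lemma eq_of_sympl_eq {a b : PVec m} (h : ∀ c, sympl a c = sympl b c) : a = b := by
  have : a + b = 0 := eq_zero_of_sympl_eq_zero fun c => by
    rw [sympl_add_left, h c, CharTwo.add_self_eq_zero]
  exact pi_eq_of_add_eq_zero this

lemma symplForm_nondegenerate : (symplForm m).Nondegenerate := by
  refine ⟨fun a h => eq_zero_of_sympl_eq_zero h, fun a h => eq_zero_of_sympl_eq_zero fun b => ?_⟩
  rw [sympl_comm]; exact h b

/-- `K` need not be a subspace, but its span is again isotropic. The span lies in its own orthogonal
complement, of codimension equal to its dimension, so this dimension is at most `m`. -/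
lemma card_le_of_isotropic {K : Set (PVec m)} (h : ∀ a ∈ K, ∀ b ∈ K, sympl a b = 0) :
    K.ncard ≤ 2 ^ m := by
  set S := Submodule.span (ZMod 2) K
  have hS : S ≤ (symplForm m).orthogonal S := by
    refine Submodule.span_le.2 fun a ha => ?_
    refine (LinearMap.BilinForm.mem_orthogonal_iff).2 fun b hb => ?_
    induction hb using Submodule.span_induction with
    | mem b hb => exact h b hb a ha
    | zero => simp
    | add x y _ _ hx hy => rw [map_add, LinearMap.add_apply, hx, hy, add_zero]
    | smul c x _ hx => rw [map_smul, LinearMap.smul_apply, hx, smul_zero]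
  have h1 := Submodule.finrank_mono hS
  rw [LinearMap.BilinForm.finrank_orthogonal symplForm_nondegenerate,
    Module.finrank_fintype_fun_eq_card] at h1
  have h2 : Module.finrank (ZMod 2) S ≤ m := by
    simp only [Fintype.card_sum, Fintype.card_fin] at h1
    omega
  calc K.ncard ≤ (S : Set (PVec m)).ncard := Set.ncard_le_ncard Submodule.subset_span
    _ = Nat.card S := rfl
    _ = 2 ^ Module.finrank (ZMod 2) S := by
      rw [Module.natCard_eq_pow_finrank (K := ZMod 2), Nat.card_zmod]
    _ ≤ 2 ^ m := Nat.pow_le_pow_right (by norm_num) h2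

/-- Maximal isotropic sets (Lagrangian subspaces). -/
def IsLagrangian (K : Set (PVec m)) : Prop := ∀ a, a ∈ K ↔ ∀ b ∈ K, sympl a b = 0

/-- A vector orthogonal to `K` but outside it could be adjoined, giving an isotropic set that is too
large. In particular a class of a Pauli partition is closed under addition without this being
assumed. -/
lemma isLagrangian_of_ncard {K : Set (PVec m)} (h : ∀ a ∈ K, ∀ b ∈ K, sympl a b = 0)
    (hc : K.ncard = 2 ^ m) : IsLagrangian K := by
  refine fun a => ⟨h a, fun ha => by_contra fun hK => ?_⟩
  have h1 : (insert a K).ncard ≤ 2 ^ m := by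
    refine card_le_of_isotropic ?_
    rintro x (rfl | hx) y (rfl | hy)
    · exact sympl_self _
    · exact ha y hy
    · rw [sympl_comm]; exact ha x hx
    · exact h x hx y hy
  rw [Set.ncard_insert_of_notMem hK, hc] at h1
  omega

lemma IsLagrangian.add_mem {K : Set (PVec m)} (h : IsLagrangian K) {a b : PVec m} (ha : a ∈ K)
    (hb : b ∈ K) : a + b ∈ K :=
  (h _).2 fun c hc => by rw [sympl_add_left, (h a).1 ha c hc, (h b).1 hb c hc, add_zero]

lemma IsLagrangian.eq_of_subset {K K' : Set (PVec m)} (h : IsLagrangian K)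
    (h' : IsLagrangian K') (hs : K ⊆ K') : K = K' :=
  hs.antisymm fun a ha => (h a).2 fun b hb => (h' a).1 ha b (hs hb)

/-! ### Pauli operators without phases -/

/-- The operator `Z^(a^z) X^(a^x)`. -/
def weyl (a : PVec m) : QMat m :=
  Matrix.of fun x y => if x = y + xPart a then sgn (zPart a ⬝ᵥ x) else 0

lemma weyl_apply (a : PVec m) (x y : Fin m → ZMod 2) :
    weyl a x y = if x = y + xPart a then sgn (zPart a ⬝ᵥ x) else 0 := rfl

lemma weyl_elim_apply (z q x y : Fin m → ZMod 2) :
    weyl (Sum.elim z q) x y = if x = y + q then sgn (z ⬝ᵥ x) else 0 := rfl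

lemma pauliZ_pow_mul_pauliX_pow (p q s t : ZMod 2) :
    (pauliZ ^ p.val * pauliX ^ q.val) s t = if s = t + q then sgn (p * s) else 0 := by
  have h : (1 + 1 : ZMod 2) = 0 := by decide
  rcases zmod_two_cases p with rfl | rfl <;> rcases zmod_two_cases q with rfl | rfl <;>
    rcases zmod_two_cases s with rfl | rfl <;> rcases zmod_two_cases t with rfl | rfl <;>
      simp [pauliZ, pauliX, h, ZMod.val_one]

/-- The phase of a Pauli operator. -/
def pauliPhase (a : PVec m) : ℂ := ∏ k : Fin m, (-Complex.I) ^ ((zPart a k).val * (xPart a k).val)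

lemma pauliPhase_ne_zero (a : PVec m) : pauliPhase a ≠ 0 :=
  Finset.prod_ne_zero_iff.2 fun _ _ => pow_ne_zero _ (neg_ne_zero.2 Complex.I_ne_zero)

/-- Phases affect neither commutation nor eigenvectors, so the arguments below can use the real
operators `weyl`. -/
lemma pauli_eq_smul_weyl (a : PVec m) : pauli a = pauliPhase a • weyl a := by
  ext x y
  simp only [pauli, Matrix.of_apply, Matrix.smul_apply, pauliZ_pow_mul_pauliX_pow, smul_eq_mul,
    Finset.prod_mul_distrib, pauliPhase, weyl_apply]
  congr 1
  split_ifs with h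
  · rw [dotProduct, sgn_sum]
    refine Finset.prod_congr rfl fun k _ => ?_
    exact if_pos (congrFun h k)
  · obtain ⟨k, hk⟩ := Function.ne_iff.1 h
    exact Finset.prod_eq_zero (Finset.mem_univ k) (if_neg hk)

/-- The sign comes from moving the `X` part of `a` past the `Z` part of `b`. -/
lemma weyl_mul (a b : PVec m) :
    weyl a * weyl b = sgn (zPart b ⬝ᵥ xPart a) • weyl (a + b) := by
  ext x y
  have hz : zPart (a + b) = zPart a + zPart b := rfl
  have hx : xPart (a + b) = xPart a + xPart b := rfl
  simp only [Matrix.mul_apply, weyl_apply, Matrix.smul_apply, smul_eq_mul, mul_ite, mul_zero]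
  rw [Finset.sum_ite_eq' Finset.univ (y + xPart b)]
  simp only [Finset.mem_univ, if_true, ite_mul, zero_mul, hx, hz]
  have : x = y + xPart b + xPart a ↔ x = y + (xPart a + xPart b) := by
    rw [add_assoc, add_comm (xPart b)]
  simp only [this]
  split_ifs with h
  · have h' : y + xPart b = x + xPart a := by
      rw [h, add_comm (xPart a), ← add_assoc, add_assoc _ (xPart a), pi_add_self,
        add_zero]
    rw [h', add_dotProduct, dotProduct_add, sgn_add, sgn_add]
    ring
  · rfl

@[simp] lemma weyl_zero : weyl (0 : PVec m) = 1 := by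
  ext x y
  have hz : zPart (0 : PVec m) = 0 := rfl
  have hx : xPart (0 : PVec m) = 0 := rfl
  rw [weyl_apply, hz, hx, Matrix.one_apply]
  simp

lemma weyl_mul_comm (a b : PVec m) : weyl a * weyl b = sgn (sympl a b) • (weyl b * weyl a) := by
  rw [weyl_mul, weyl_mul, smul_smul, add_comm b a]
  congr 1
  have h := sgn_mul_self (zPart a ⬝ᵥ xPart b)
  rw [sympl, sgn_add, dotProduct_comm (xPart a)]
  linear_combination -sgn (zPart b ⬝ᵥ xPart a) * h

lemma weyl_conjTranspose_mul_self (a : PVec m) : (weyl a)ᴴ * weyl a = 1 := by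
  ext x y
  simp only [Matrix.mul_apply, Matrix.conjTranspose_apply, weyl_apply, mul_ite, mul_zero]
  rw [Finset.sum_ite_eq' Finset.univ (y + xPart a)]
  simp only [Finset.mem_univ, if_true, add_left_inj, Matrix.one_apply, eq_comm (a := x)]
  split_ifs with h
  · rw [star_sgn, sgn_mul_self]
  · simp

lemma weyl_mul_conjTranspose_self (a : PVec m) : weyl a * (weyl a)ᴴ = 1 :=
  mul_eq_one_comm.1 (weyl_conjTranspose_mul_self a)

lemma weyl_ne_zero (a : PVec m) : weyl a ≠ 0 := fun h => by
  have := weyl_conjTranspose_mul_self a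
  rw [h, mul_zero] at this
  exact zero_ne_one this

lemma weyl_commute_iff (a b : PVec m) : Commute (weyl a) (weyl b) ↔ sympl a b = 0 := by
  constructor
  · intro h
    have h1 := weyl_mul_comm a b
    rw [← h.eq] at h1
    have h2 : weyl a * weyl b ≠ 0 := by
      rw [weyl_mul]; exact smul_ne_zero (sgn_ne_zero _) (weyl_ne_zero _)
    have h3 : (1 - sgn (sympl a b)) • (weyl a * weyl b) = 0 := by
      rw [sub_smul, one_smul, ← h1, sub_self]
    have h4 := (smul_eq_zero.1 h3).resolve_right h2
    exact sgn_injective (by rw [sgn_zero]; linear_combination -h4)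
  · intro h
    rw [Commute, SemiconjBy, weyl_mul_comm, h, sgn_zero, one_smul]

lemma pauli_commute_iff (a b : PVec m) : Commute (pauli a) (pauli b) ↔ sympl a b = 0 := by
  rw [← weyl_commute_iff, pauli_eq_smul_weyl, pauli_eq_smul_weyl,
    Commute.smul_left_iff₀ (pauliPhase_ne_zero a), Commute.smul_right_iff₀ (pauliPhase_ne_zero b)]

/-- Every matrix is a combination of Pauli operators. -/
lemma weyl_expansion (X : QMat m) :
    ((2 : ℂ) ^ m) • X = ∑ a : PVec m, ((weyl a)ᴴ * X).trace • weyl a := by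
  ext x y
  simp only [Matrix.sum_apply, Matrix.smul_apply, smul_eq_mul, Matrix.trace, Matrix.diag,
    Matrix.mul_apply, Matrix.conjTranspose_apply]
  rw [sum_pVec]
  -- At the entry `(x, y)` only `q = x + y` contributes; the sum over `z` then leaves `v = y` alone,
  -- by orthogonality of characters.
  have h1 : ∀ z q : Fin m → ZMod 2,
      (∑ v, ∑ u, star (weyl (Sum.elim z q) u v) * X u v) * weyl (Sum.elim z q) x y =
      if q = x + y then ∑ v, sgn (z ⬝ᵥ (v + y)) * X (v + q) v else 0 := by
    intro z q
    simp only [weyl_elim_apply]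
    have h2 : x = y + q ↔ q = x + y := by
      constructor
      · rintro rfl; rw [add_right_comm, pi_add_self, zero_add]
      · rintro rfl; rw [add_left_comm, pi_add_self, add_zero]
    simp only [h2]
    split_ifs with h
    · rw [Finset.sum_mul]
      refine Finset.sum_congr rfl fun v _ => ?_
      rw [Finset.sum_eq_single (v + q)]
      · rw [if_pos rfl, star_sgn, mul_right_comm, ← sgn_add, ← dotProduct_add, h, ← add_assoc,
          add_right_comm _ y x, add_assoc v x x, pi_add_self, add_zero]
      · intro u _ hu
        rw [if_neg hu, star_zero, zero_mul]
      · simp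
    · rw [mul_zero]
  rw [Finset.sum_congr rfl fun z _ => Finset.sum_congr rfl fun q _ => h1 z q]
  simp only [Finset.sum_ite_eq', Finset.mem_univ, if_true]
  rw [Finset.sum_comm]
  rw [Finset.sum_eq_single y]
  · rw [← Finset.sum_mul, sum_sgn_dotProduct, if_pos (pi_add_self y), add_left_comm, pi_add_self,
      add_zero, Fintype.card_fin]
  · intro v _ hv
    rw [← Finset.sum_mul, sum_sgn_dotProduct, if_neg fun h => hv (pi_eq_of_add_eq_zero h),
      zero_mul]
  · simp

lemma eq_sum_weyl (X : QMat m) :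
    X = ∑ a : PVec m, (((2 : ℂ) ^ m)⁻¹ * ((weyl a)ᴴ * X).trace) • weyl a := by
  simp only [mul_smul, ← Finset.smul_sum]
  rw [← weyl_expansion, smul_smul, inv_mul_cancel₀ (pow_ne_zero _ two_ne_zero), one_smul]

end CyclicMUB

/-! ### Rigidity from commutation relations, eigenbases and unbiasedness -/

namespace CyclicMUB

variable {m : ℕ}

/-! ### Operators determined by their commutation with Pauli operators -/

lemma conjTranspose_weyl_mul_comm (a b : PVec m) :
    (weyl a)ᴴ * weyl b = sgn (sympl a b) • (weyl b * (weyl a)ᴴ) := by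
  have h : weyl b * (weyl a)ᴴ = sgn (sympl a b) • ((weyl a)ᴴ * weyl b) := by
    calc weyl b * (weyl a)ᴴ = (weyl a)ᴴ * (weyl a * weyl b) * (weyl a)ᴴ := by
          rw [← mul_assoc (weyl a)ᴴ, weyl_conjTranspose_mul_self, one_mul]
      _ = _ := by
          rw [weyl_mul_comm, mul_smul_comm, smul_mul_assoc, mul_assoc, mul_assoc (weyl b),
            weyl_mul_conjTranspose_self, mul_one]
  rw [h, smul_smul, sgn_mul_self, one_smul]

/-- Conjugation by `weyl b` scales the Pauli coefficient at `a` by a sign. A nonzero coefficient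
therefore forces `χ * sgn (sympl a b) = 1`. -/
lemma trace_eq_of_mul_weyl_eq {X : QMat m} {b : PVec m} {χ : ℂ}
    (h : X * weyl b = χ • (weyl b * X)) (a : PVec m) :
    ((weyl a)ᴴ * X).trace = χ * sgn (sympl a b) * ((weyl a)ᴴ * X).trace := by
  conv_lhs => rw [← mul_one X, ← weyl_mul_conjTranspose_self b, ← mul_assoc X, h, ← mul_assoc,
    Matrix.trace_mul_comm, mul_smul_comm, mul_smul_comm, ← mul_assoc (weyl a)ᴴ,
    conjTranspose_weyl_mul_comm, smul_mul_assoc, mul_smul_comm, mul_assoc (weyl b),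
    ← mul_assoc (weyl b)ᴴ, weyl_conjTranspose_mul_self, one_mul, Matrix.trace_smul,
    Matrix.trace_smul, smul_eq_mul, smul_eq_mul, ← mul_assoc]

lemma exists_trace_ne_zero {X : QMat m} (hX : X ≠ 0) : ∃ a, ((weyl a)ᴴ * X).trace ≠ 0 := by
  by_contra! h
  apply hX
  rw [eq_sum_weyl X]
  exact Finset.sum_eq_zero fun a _ => by rw [h a, mul_zero, zero_smul]

/-- The scalars `χ` fix the value of `sympl a b` for every `b ∈ S` and every `a` in the Pauli
support of `X`. As `S` separates vectors, the support is a single point. -/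
lemma exists_eq_smul_weyl {X : QMat m} (hX : X ≠ 0) {S : Set (PVec m)}
    (hS : ∀ a, (∀ b ∈ S, sympl a b = 0) → a = 0)
    (h : ∀ b ∈ S, ∃ χ : ℂ, X * weyl b = χ • (weyl b * X)) : ∃ a, ∃ c : ℂ, c ≠ 0 ∧ X = c • weyl a := by
  choose χ hχ using h
  have key : ∀ a, ((weyl a)ᴴ * X).trace ≠ 0 →
      ∀ b (hb : b ∈ S), χ b hb * sgn (sympl a b) = 1 := by
    intro a ha b hb
    have := trace_eq_of_mul_weyl_eq (hχ b hb) a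
    exact mul_right_cancel₀ ha (by rw [one_mul]; exact this.symm)
  obtain ⟨a, ha⟩ := exists_trace_ne_zero hX
  refine ⟨a, ((2 : ℂ) ^ m)⁻¹ * ((weyl a)ᴴ * X).trace,
    mul_ne_zero (inv_ne_zero (pow_ne_zero _ two_ne_zero)) ha, ?_⟩
  conv_lhs => rw [eq_sum_weyl X]
  refine Finset.sum_eq_single a (fun a' _ ha' => ?_) (by simp)
  by_cases h0 : ((weyl a')ᴴ * X).trace = 0
  · rw [h0, mul_zero, zero_smul]
  · refine absurd (pi_eq_of_add_eq_zero (hS _ fun b hb => ?_)) ha'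
    have h1 := key a ha b hb
    have hχ0 : χ b hb ≠ 0 := fun h => by rw [h, zero_mul] at h1; exact zero_ne_one h1
    rw [sympl_add_left,
      sgn_injective (mul_left_cancel₀ hχ0 ((key a' h0 b hb).trans h1.symm)),
      CharTwo.add_self_eq_zero]

lemma eq_of_smul_weyl_eq {a b : PVec m} {c : ℂ} (h : c • weyl a = weyl b) : a = b := by
  have hc : c ≠ 0 := by
    rintro rfl
    rw [zero_smul] at h
    exact weyl_ne_zero b h.symm
  refine eq_of_sympl_eq fun d => sgn_injective ?_
  have h1 := weyl_mul_comm b d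
  rw [← h, smul_mul_assoc, weyl_mul_comm a d, mul_smul_comm, smul_comm c, smul_comm _ c,
    smul_comm _ c] at h1
  have h2 := smul_right_injective _ hc h1
  have h3 : weyl d * weyl a ≠ 0 := by
    rw [weyl_mul]; exact smul_ne_zero (sgn_ne_zero _) (weyl_ne_zero _)
  exact smul_left_injective ℂ h3 h2

/-- A form of Schur's lemma: the support point must be orthogonal to `S`, hence zero. -/
lemma exists_eq_smul_one {X : QMat m} {S : Set (PVec m)}
    (hS : ∀ a, (∀ b ∈ S, sympl a b = 0) → a = 0) (h : ∀ b ∈ S, Commute X (weyl b)) :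
    ∃ c : ℂ, X = c • 1 := by
  rcases eq_or_ne X 0 with rfl | hX
  · exact ⟨0, by simp⟩
  obtain ⟨a, c, hc, rfl⟩ := exists_eq_smul_weyl hX hS fun b hb =>
    ⟨1, by rw [one_smul]; exact h b hb⟩
  have : a = 0 := hS a fun b hb =>
    (weyl_commute_iff a b).1 ((Commute.smul_left_iff₀ hc).1 (h b hb))
  exact ⟨c, by rw [this, weyl_zero]⟩

/-- The operators commuting with a maximal class are the combinations of its elements. -/
lemma mem_span_weyl_of_commute {K : Set (PVec m)} (hK : IsLagrangian K) {X : QMat m}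
    (h : ∀ b ∈ K, Commute X (weyl b)) : X ∈ Submodule.span ℂ (weyl '' K) := by
  rw [eq_sum_weyl X]
  refine Submodule.sum_mem _ fun a _ => ?_
  by_cases ha : a ∈ K
  · exact Submodule.smul_mem _ _ (Submodule.subset_span ⟨a, ha, rfl⟩)
  -- Some `b ∈ K` anticommutes with `a`, so the coefficient at `a` equals its negative.
  · rw [hK] at ha
    push Not at ha
    obtain ⟨b, hb, hab⟩ := ha
    have h1 := trace_eq_of_mul_weyl_eq (χ := 1) ((h b hb).eq.trans (one_smul ℂ _).symm) a
    rw [(zmod_two_cases _).resolve_left hab, sgn_one] at h1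
    have h2 : ((weyl a)ᴴ * X).trace = 0 := by linear_combination (1 / 2 : ℂ) * h1
    rw [h2, mul_zero, zero_smul]
    exact Submodule.zero_mem _

/-! ### Eigenbases of maximal classes -/

lemma conjTranspose_mul_of_mem {U : QMat m} (h : U ∈ Matrix.unitaryGroup (Fin m → ZMod 2) ℂ) :
    Uᴴ * U = 1 := Matrix.mem_unitaryGroup_iff'.1 h

lemma mul_conjTranspose_of_mem {U : QMat m} (h : U ∈ Matrix.unitaryGroup (Fin m → ZMod 2) ℂ) :
    U * Uᴴ = 1 := Matrix.mem_unitaryGroup_iff.1 h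

lemma conjTranspose_mem {U : QMat m} (h : U ∈ Matrix.unitaryGroup (Fin m → ZMod 2) ℂ) :
    Uᴴ ∈ Matrix.unitaryGroup (Fin m → ZMod 2) ℂ := by
  rw [Matrix.mem_unitaryGroup_iff, Matrix.star_eq_conjTranspose, Matrix.conjTranspose_conjTranspose]
  exact conjTranspose_mul_of_mem h

/-- An orthonormal basis of common eigenvectors of a class. -/
def IsEigenbasis (K : Set (PVec m)) (V : QMat m) : Prop :=
  V ∈ Matrix.unitaryGroup (Fin m → ZMod 2) ℂ ∧ ∀ a ∈ K, (Vᴴ * weyl a * V).IsDiag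

lemma isEigenbasisFamily_iff {K : Fin (2 ^ m + 1) → Set (PVec m)}
    {𝓑 : Fin (2 ^ m + 1) → QMat m} :
    IsEigenbasisFamily K 𝓑 ↔ ∀ j, IsEigenbasis (K j) (𝓑 j) := by
  refine forall_congr' fun j => and_congr_right fun _ => forall₂_congr fun a _ => ?_
  rw [pauli_eq_smul_weyl, mul_smul_comm, smul_mul_assoc]
  refine ⟨fun h => ?_, fun h => h.smul _⟩
  have := h.smul (pauliPhase a)⁻¹
  rwa [smul_smul, inv_mul_cancel₀ (pauliPhase_ne_zero a), one_smul] at this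

lemma IsDiag.commute {n : Type*} [Fintype n] [DecidableEq n] {X Y : Matrix n n ℂ} (hX : X.IsDiag)
    (hY : Y.IsDiag) : Commute X Y := by
  rw [← hX.diagonal_diag, ← hY.diagonal_diag]
  exact Matrix.commute_diagonal _ _

lemma commute_of_isDiag {V X Y : QMat m} (hV : V ∈ Matrix.unitaryGroup (Fin m → ZMod 2) ℂ)
    (hX : (Vᴴ * X * V).IsDiag) (hY : (Vᴴ * Y * V).IsDiag) : Commute X Y := by
  have h1 := mul_conjTranspose_of_mem hV
  have h2 : ∀ Z : QMat m, V * (Vᴴ * Z * V) * Vᴴ = Z := fun Z => by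
    calc V * (Vᴴ * Z * V) * Vᴴ = (V * Vᴴ) * Z * (V * Vᴴ) := by simp only [mul_assoc]
      _ = Z := by rw [h1, one_mul, mul_one]
  have h3 : ∀ Z Z' : QMat m, V * ((Vᴴ * Z * V) * (Vᴴ * Z' * V)) * Vᴴ = Z * Z' := fun Z Z' => by
    calc V * ((Vᴴ * Z * V) * (Vᴴ * Z' * V)) * Vᴴ = (V * Vᴴ) * Z * (V * Vᴴ) * Z' * (V * Vᴴ) := by
          simp only [mul_assoc]
      _ = Z * Z' := by rw [h1, one_mul, mul_one, mul_one]
  have h4 := (IsDiag.commute hX hY).eq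
  rw [Commute, SemiconjBy, ← h3 X Y, h4, h3]

lemma IsEigenbasis.isDiag_of_commute {K : Set (PVec m)} (hK : IsLagrangian K) {V : QMat m}
    (hV : IsEigenbasis K V) {X : QMat m} (h : ∀ b ∈ K, Commute X (weyl b)) :
    (Vᴴ * X * V).IsDiag := by
  have hX := mem_span_weyl_of_commute hK h
  clear h
  induction hX using Submodule.span_induction with
  | mem x hx => obtain ⟨a, ha, rfl⟩ := hx; exact hV.2 a ha
  | zero => simp
  | add x y _ _ hx hy => rw [mul_add, add_mul]; exact hx.add hy
  | smul c x _ hx => rw [mul_smul_comm, smul_mul_assoc]; exact hx.smul c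

/-- The expectation values of Pauli operators outside of a maximal class vanish. -/
lemma IsEigenbasis.apply_eq_zero {K : Set (PVec m)} (hK : IsLagrangian K) {V : QMat m}
    (hV : IsEigenbasis K V) {a : PVec m} (ha : a ∉ K) (k : Fin m → ZMod 2) :
    (Vᴴ * weyl a * V) k k = 0 := by
  rw [hK] at ha
  push Not at ha
  obtain ⟨b, hb, hab⟩ := ha
  have h1 := mul_conjTranspose_of_mem hV.1
  have h3 : ∀ c d : PVec m, (Vᴴ * weyl c * V) * (Vᴴ * weyl d * V) = Vᴴ * (weyl c * weyl d) * V :=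
    fun c d => by
      calc (Vᴴ * weyl c * V) * (Vᴴ * weyl d * V) = Vᴴ * weyl c * (V * Vᴴ) * weyl d * V := by
            simp only [mul_assoc]
        _ = _ := by rw [h1, mul_one]; simp only [mul_assoc]
  set G := Vᴴ * weyl a * V with hG
  obtain ⟨e, he⟩ : ∃ e, Vᴴ * weyl b * V = Matrix.diagonal e :=
    ⟨_, (hV.2 b hb).diagonal_diag.symm⟩
  -- In the basis `V` the operator of `a` anticommutes with a diagonal matrix whose entries are
  -- nonzero by unitarity; this kills the diagonal of `G`.
  have h4 : G * Matrix.diagonal e = -(Matrix.diagonal e * G) := by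
    rw [← he, hG, h3, h3, weyl_mul_comm a b, (zmod_two_cases _).resolve_left hab, sgn_one]
    simp
  have h5 : e k ≠ 0 := by
    intro h0
    have h6 : (Vᴴ * weyl b * V)ᴴ * (Vᴴ * weyl b * V) = 1 := by
      rw [Matrix.conjTranspose_mul, Matrix.conjTranspose_mul, Matrix.conjTranspose_conjTranspose]
      calc Vᴴ * ((weyl b)ᴴ * V) * (Vᴴ * weyl b * V) = Vᴴ * ((weyl b)ᴴ * (V * Vᴴ) * weyl b) * V := by
            simp only [mul_assoc]
        _ = 1 := by rw [h1, mul_one, weyl_conjTranspose_mul_self, mul_one,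
                conjTranspose_mul_of_mem hV.1]
    rw [he, Matrix.diagonal_conjTranspose, Matrix.diagonal_mul_diagonal] at h6
    have := congrFun (congrFun h6 k) k
    simp [h0] at this
  have h7 := congrFun (congrFun h4 k) k
  rw [Matrix.mul_diagonal, Matrix.neg_apply, Matrix.diagonal_mul] at h7
  have h8 : e k * G k k = 0 := by linear_combination (1 / 2 : ℂ) * h7
  exact (mul_eq_zero.1 h8).resolve_left h5

/-- Eigenbases of maximal classes with only the identity in common are mutually unbiased. -/
lemma mutuallyUnbiased_of_inter {K L : Set (PVec m)} (hK : IsLagrangian K) (hL : IsLagrangian L)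
    (hKL : ∀ a ∈ K, a ∈ L → a = 0) {U V : QMat m} (hU : IsEigenbasis K U)
    (hV : IsEigenbasis L V) : MutuallyUnbiased U V := by
  intro k l
  -- `Φ` is the projector onto the `l`-th vector of `V`, so the squared overlap is a diagonal entry
  -- of `Uᴴ * Φ * U`.
  set Φ : QMat m := V * Matrix.single l l 1 * Vᴴ with hΦ
  have tr : ∀ X : QMat m, (X * Φ).trace = (Vᴴ * X * V) l l := fun X => by
    rw [hΦ, ← mul_assoc, ← mul_assoc, Matrix.trace_mul_comm, ← mul_assoc, ← mul_assoc,
      Matrix.trace_mul_single]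
    simp
  have h1 : (Uᴴ * Φ * U) k k = ((‖(Uᴴ * V) k l‖ ^ 2 : ℝ) : ℂ) := by
    have : Uᴴ * Φ * U = (Uᴴ * V) * Matrix.single l l 1 * (Uᴴ * V)ᴴ := by
      rw [hΦ, Matrix.conjTranspose_mul, Matrix.conjTranspose_conjTranspose]
      simp only [mul_assoc]
    rw [this, Matrix.mul_apply, Finset.sum_eq_single l]
    · rw [Matrix.mul_single_apply_same, mul_one, Matrix.conjTranspose_apply]
      rw [Complex.star_def, Complex.mul_conj, Complex.normSq_eq_norm_sq]
    · intro b _ hb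
      rw [Matrix.mul_single_apply_of_ne _ _ _ _ _ hb, zero_mul]
    · simp
  -- In the Pauli expansion of `Φ`, a nonzero `a` lies outside `K` or outside `L`: its expectation
  -- value vanishes in `U` or its coefficient vanishes. The identity contributes `2 ^ (-m)`.
  have h2 : (Uᴴ * Φ * U) k k = ((2 : ℂ) ^ m)⁻¹ := by
    rw [eq_sum_weyl Φ, Matrix.mul_sum, Matrix.sum_mul, Matrix.sum_apply,
      Finset.sum_eq_single (0 : PVec m)]
    · rw [tr, weyl_zero, mul_smul_comm, smul_mul_assoc, mul_one, conjTranspose_mul_of_mem hU.1,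
        Matrix.conjTranspose_one, mul_one, conjTranspose_mul_of_mem hV.1]
      simp
    · intro a _ ha
      rw [mul_smul_comm, smul_mul_assoc, Matrix.smul_apply, smul_eq_mul]
      by_cases haK : a ∈ K
      · have h0 := hV.apply_eq_zero hL (fun haL => ha (hKL a haK haL)) l
        have h3 : (Vᴴ * (weyl a)ᴴ * V) l l = star ((Vᴴ * weyl a * V) l l) := by
          rw [← Matrix.conjTranspose_apply, Matrix.conjTranspose_mul, Matrix.conjTranspose_mul,
            Matrix.conjTranspose_conjTranspose, mul_assoc]
        rw [tr, h3, h0, star_zero, mul_zero, zero_mul]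
      · rw [hU.apply_eq_zero hK haK, mul_zero]
    · simp
  rw [h1] at h2
  have h3 : ((‖(Uᴴ * V) k l‖ ^ 2 : ℝ) : ℂ) = ((1 / (2 : ℝ) ^ m : ℝ) : ℂ) := by
    rw [h2]; push_cast; rw [one_div]
  exact Complex.ofReal_injective h3

/-- A unitary matrix that transforms diagonal matrices to diagonal matrices is monomial. -/
lemma isMonomial_of_isDiag {W : QMat m} (hW : W ∈ Matrix.unitaryGroup (Fin m → ZMod 2) ℂ)
    (h : ∀ k, (Wᴴ * Matrix.single k k 1 * W).IsDiag) : IsMonomial W := by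
  -- The entry `(l, l')` of the transformed matrix unit is `star (W k l) * W k l'`, so each row of
  -- `W` has at most one nonzero entry. Unitarity then makes these positions a permutation.
  have h1 : ∀ k l l', l ≠ l' → W k l = 0 ∨ W k l' = 0 := by
    intro k l l' hl
    have := h k hl
    rw [mul_assoc, Matrix.mul_apply, Finset.sum_eq_single k] at this
    · rw [Matrix.single_mul_apply_same, one_mul, Matrix.conjTranspose_apply, mul_eq_zero,
        star_eq_zero] at this
      exact this
    · intro b _ hb
      rw [Matrix.single_mul_apply_of_ne _ _ _ _ _ hb, mul_zero]
    · simp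
  have hWW := mul_conjTranspose_of_mem hW
  have h2 : ∀ k, ∃ l, W k l ≠ 0 := by
    intro k
    by_contra! h0
    have := congrFun (congrFun hWW k) k
    simp [Matrix.mul_apply, h0] at this
  choose τ hτ using h2
  have h3 : ∀ k l, l ≠ τ k → W k l = 0 := fun k l hl => (h1 k l _ hl).resolve_right (hτ k)
  have h4 : ∀ k k', (W * Wᴴ) k k' = W k (τ k) * star (W k' (τ k)) := by
    intro k k'
    rw [Matrix.mul_apply, Finset.sum_eq_single (τ k)]
    · rfl
    · intro b _ hb
      rw [h3 k b hb, zero_mul]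
    · simp
  have hinj : Function.Injective τ := by
    intro k k' hk
    by_contra hne
    have := h4 k k'
    rw [hWW, Matrix.one_apply_ne hne, eq_comm, mul_eq_zero, star_eq_zero] at this
    exact this.elim (hτ k) (by rw [hk]; exact hτ k')
  refine ⟨fun k => W k (τ k), fun k => ?_, Equiv.ofBijective τ
    (Finite.injective_iff_bijective.1 hinj), ?_⟩
  · have := h4 k k
    rw [hWW, Matrix.one_apply_eq, Complex.star_def, Complex.mul_conj,
      Complex.normSq_eq_norm_sq] at this
    have h5 : ‖W k (τ k)‖ ^ 2 = 1 := by exact_mod_cast this.symm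
    exact (pow_eq_one_iff_of_nonneg (norm_nonneg _) two_ne_zero).1 h5
  · ext k l
    rw [Matrix.diagonal_mul, Equiv.Perm.permMatrix, PEquiv.toMatrix_apply]
    by_cases hl : l = τ k
    · simp [hl]
    · rw [h3 k l hl]
      simp [Ne.symm hl]

/-- Two eigenbases of the same maximal class differ by a monomial matrix. -/
lemma IsEigenbasis.exists_monomial {K : Set (PVec m)} (hK : IsLagrangian K) {U V : QMat m}
    (hU : IsEigenbasis K U) (hV : IsEigenbasis K V) : ∃ W, IsMonomial W ∧ V = U * W := by
  refine ⟨Uᴴ * V, isMonomial_of_isDiag (mul_mem (conjTranspose_mem hU.1) hV.1) fun k => ?_, ?_⟩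
  · have : (Uᴴ * V)ᴴ * Matrix.single k k 1 * (Uᴴ * V) =
        Vᴴ * (U * Matrix.single k k 1 * Uᴴ) * V := by
      rw [Matrix.conjTranspose_mul, Matrix.conjTranspose_conjTranspose]
      simp only [mul_assoc]
    rw [this]
    -- The projector onto the `k`-th vector of `U` commutes with the class because both are diagonal
    -- in `U`; maximality of the class makes it diagonal in `V` as well.
    refine hV.isDiag_of_commute hK fun b hb => commute_of_isDiag hU.1 ?_ (hU.2 b hb)
    have h1 := conjTranspose_mul_of_mem hU.1
    have : Uᴴ * (U * Matrix.single k k 1 * Uᴴ) * U = Matrix.diagonal (Pi.single k 1) := by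
      calc Uᴴ * (U * Matrix.single k k 1 * Uᴴ) * U =
          (Uᴴ * U) * Matrix.single k k 1 * (Uᴴ * U) := by simp only [mul_assoc]
        _ = _ := by rw [h1, one_mul, mul_one, Matrix.diagonal_single]
    rw [this]
    exact Matrix.isDiag_diagonal _
  · rw [← mul_assoc, mul_conjTranspose_of_mem hU.1, one_mul]

lemma IsMonomial.isDiag_conj {W : QMat m} (hW : IsMonomial W) {E : QMat m} (hE : E.IsDiag) :
    (Wᴴ * E * W).IsDiag := by
  obtain ⟨c, -, τ, rfl⟩ := hW
  have h1 : ∀ k l, (Matrix.diagonal c * τ.permMatrix ℂ) k l = if τ k = l then c k else 0 := by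
    intro k l
    simp [Matrix.diagonal_mul, Equiv.Perm.permMatrix, PEquiv.toMatrix_apply, eq_comm]
  rw [← hE.diagonal_diag]
  intro k l hkl
  rw [Matrix.mul_apply]
  refine Finset.sum_eq_zero fun x _ => ?_
  rw [Matrix.mul_diagonal, Matrix.conjTranspose_apply, h1, h1]
  by_cases hk : τ x = k
  · rw [if_neg fun hl : τ x = l => hkl (hk.symm.trans hl), mul_zero]
  · rw [if_neg hk, star_zero, zero_mul, zero_mul]

end CyclicMUB

/-! ### From equivalences of bases to symplectic maps -/

namespace CyclicMUB

variable {m : ℕ}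

/-! ### Clifford operators -/

lemma conj_mul_conj {U : QMat m} (hU : U ∈ Matrix.unitaryGroup (Fin m → ZMod 2) ℂ) (X Y : QMat m) :
    (U * X * Uᴴ) * (U * Y * Uᴴ) = U * (X * Y) * Uᴴ := by
  calc (U * X * Uᴴ) * (U * Y * Uᴴ) = U * X * (Uᴴ * U) * Y * Uᴴ := by simp only [mul_assoc]
    _ = _ := by rw [conjTranspose_mul_of_mem hU, mul_one]; simp only [mul_assoc]

lemma conj_conjTranspose_conj {U : QMat m} (hU : U ∈ Matrix.unitaryGroup (Fin m → ZMod 2) ℂ)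
    (X : QMat m) : U * (Uᴴ * X * U) * Uᴴ = X := by
  calc U * (Uᴴ * X * U) * Uᴴ = (U * Uᴴ) * X * (U * Uᴴ) := by simp only [mul_assoc]
    _ = _ := by rw [mul_conjTranspose_of_mem hU, one_mul, mul_one]

lemma conjTranspose_conj_conj {U : QMat m} (hU : U ∈ Matrix.unitaryGroup (Fin m → ZMod 2) ℂ)
    (X : QMat m) : Uᴴ * (U * X * Uᴴ) * U = X := by
  have := conj_conjTranspose_conj (conjTranspose_mem hU) X
  rwa [Matrix.conjTranspose_conjTranspose] at this

lemma commute_conj_iff {U : QMat m} (hU : U ∈ Matrix.unitaryGroup (Fin m → ZMod 2) ℂ)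
    (X Y : QMat m) : Commute (U * X * Uᴴ) Y ↔ Commute X (Uᴴ * Y * U) := by
  constructor
  · intro h
    have h1 := conj_mul_conj (conjTranspose_mem hU) (U * X * Uᴴ) Y
    have h2 := conj_mul_conj (conjTranspose_mem hU) Y (U * X * Uᴴ)
    rw [Matrix.conjTranspose_conjTranspose, conjTranspose_conj_conj hU] at h1 h2
    rw [Commute, SemiconjBy, h1, h.eq, h2]
  · intro h
    have h1 := conj_mul_conj hU X (Uᴴ * Y * U)
    have h2 := conj_mul_conj hU (Uᴴ * Y * U) X
    rw [conj_conjTranspose_conj hU] at h1 h2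
    rw [Commute, SemiconjBy, h1, h.eq, h2]

lemma weyl_mem_unitaryGroup (a : PVec m) : weyl a ∈ Matrix.unitaryGroup (Fin m → ZMod 2) ℂ :=
  Matrix.mem_unitaryGroup_iff.2 (weyl_mul_conjTranspose_self a)

lemma weyl_conj (a b : PVec m) : weyl a * weyl b * (weyl a)ᴴ = sgn (sympl a b) • weyl b := by
  rw [weyl_mul_comm, smul_mul_assoc, mul_assoc, weyl_mul_conjTranspose_self, mul_one]

lemma conjTranspose_weyl_conj (a b : PVec m) :
    (weyl a)ᴴ * weyl b * weyl a = sgn (sympl a b) • weyl b := by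
  rw [conjTranspose_weyl_mul_comm, smul_mul_assoc, mul_assoc, weyl_conjTranspose_mul_self, mul_one]

lemma Commute.conjTranspose_left_of_mem {U Y : QMat m}
    (hU : U ∈ Matrix.unitaryGroup (Fin m → ZMod 2) ℂ) (h : Commute U Y) : Commute Uᴴ Y := by
  have h1 : Uᴴ * (U * Y) * Uᴴ = Uᴴ * (Y * U) * Uᴴ := by rw [h.eq]
  rw [← mul_assoc, conjTranspose_mul_of_mem hU, one_mul, mul_assoc, mul_assoc Y,
    mul_conjTranspose_of_mem hU, mul_one] at h1
  exact h1.symm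

/-- A unitary matrix that maps, for each class of a Pauli partition, the operators of the class to
operators commuting with a class of another Pauli partition is a Clifford operator. -/
lemma exists_conj_eq_smul_weyl {ι : Type*} [Nontrivial ι] {K L : ι → Set (PVec m)}
    (hK : ∀ j, IsLagrangian (K j)) (hL : ∀ j, IsLagrangian (L j))
    (hcover : ∀ a, ∃ j, a ∈ K j) (hinter : ∀ i j, i ≠ j → ∀ a ∈ L i, a ∈ L j → a = 0)
    {U : QMat m} (hU : U ∈ Matrix.unitaryGroup (Fin m → ZMod 2) ℂ)
    (h : ∀ j, ∀ a ∈ K j, ∀ b ∈ L j, Commute (U * weyl a * Uᴴ) (weyl b)) (b : PVec m) :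
    ∃ a, ∃ c : ℂ, c ≠ 0 ∧ U * weyl b * Uᴴ = c • weyl a := by
  obtain ⟨i, hb⟩ := hcover b
  obtain ⟨j, hij⟩ := exists_ne i
  -- One Lagrangian does not separate vectors, but two with zero intersection do. Hence it suffices
  -- that `D` commutes up to scalars with the operators of `L i` and of `L j`.
  have hS : ∀ a, (∀ c ∈ L i ∪ L j, sympl a c = 0) → a = 0 := fun a ha =>
    hinter j i hij a ((hL j a).2 fun c hc => ha c (Or.inr hc))
      ((hL i a).2 fun c hc => ha c (Or.inl hc))
  set D := U * weyl b * Uᴴ with hD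
  have hDm : D ∈ Matrix.unitaryGroup (Fin m → ZMod 2) ℂ :=
    mul_mem (mul_mem hU (weyl_mem_unitaryGroup b)) (conjTranspose_mem hU)
  have hDt : Dᴴ = U * (weyl b)ᴴ * Uᴴ := by
    rw [hD, Matrix.conjTranspose_mul, Matrix.conjTranspose_mul, Matrix.conjTranspose_conjTranspose,
      mul_assoc]
  have hDi : ∀ c ∈ L i, Commute D (weyl c) := fun c hc => h i b hb c hc
  -- The preimage of `weyl a` under conjugation by `U` lies in the span of `K j`. Conjugation by
  -- `weyl b` preserves that span, since it only changes signs, and `U` maps it back to operators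
  -- commuting with `L j`.
  have hDj : ∀ a ∈ L j, ∀ c ∈ L j, Commute (D * weyl a * Dᴴ) (weyl c) := by
    intro a ha c hc
    have h1 : Uᴴ * weyl a * U ∈ Submodule.span ℂ (weyl '' K j) :=
      mem_span_weyl_of_commute (hK j) fun d hd =>
        ((commute_conj_iff hU _ _).1 (h j d hd a ha)).symm
    have h2 : D * weyl a * Dᴴ = U * (weyl b * (Uᴴ * weyl a * U) * (weyl b)ᴴ) * Uᴴ := by
      rw [hDt, hD]; simp only [mul_assoc]
    rw [h2]
    generalize Uᴴ * weyl a * U = Y at h1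
    induction h1 using Submodule.span_induction with
    | mem y hy =>
      obtain ⟨d, hd, rfl⟩ := hy
      rw [weyl_conj, mul_smul_comm, smul_mul_assoc]
      exact (h j d hd c hc).smul_left _
    | zero => simp
    | add x y _ _ hx hy =>
      rw [mul_add, add_mul, mul_add, add_mul]
      exact hx.add_left hy
    | smul r x _ hx =>
      rw [mul_smul_comm, smul_mul_assoc, mul_smul_comm, smul_mul_assoc]
      exact hx.smul_left _
  refine exists_eq_smul_weyl (S := L i ∪ L j) ?_ hS ?_
  · intro h0
    have := mul_conjTranspose_of_mem hDm
    rw [h0, zero_mul] at this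
    exact zero_ne_one this
  rintro a (ha | ha)
  · exact ⟨1, by rw [one_smul]; exact hDi a ha⟩
  -- The group commutator of `D` and `weyl a` commutes with both classes, hence is a scalar.
  · obtain ⟨q, hq⟩ : ∃ q : ℂ, D * weyl a * Dᴴ * (weyl a)ᴴ = q • 1 := by
      refine exists_eq_smul_one hS ?_
      rintro c (hc | hc)
      · have h1 : Commute (weyl a * Dᴴ * (weyl a)ᴴ) (weyl c) := by
          rw [commute_conj_iff (weyl_mem_unitaryGroup a), conjTranspose_weyl_conj]
          exact (Commute.conjTranspose_left_of_mem hDm (hDi c hc)).smul_right _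
        have h2 : D * weyl a * Dᴴ * (weyl a)ᴴ = D * (weyl a * Dᴴ * (weyl a)ᴴ) := by
          simp only [mul_assoc]
        rw [h2]
        exact (hDi c hc).mul_left h1
      · exact (hDj a ha c hc).mul_left (Commute.conjTranspose_left_of_mem (weyl_mem_unitaryGroup a)
          ((weyl_commute_iff a c).2 ((hL j a).1 ha c hc)))
    refine ⟨q, ?_⟩
    calc D * weyl a = (D * weyl a * Dᴴ * (weyl a)ᴴ) * weyl a * D := by
          rw [mul_assoc (D * weyl a * Dᴴ), weyl_conjTranspose_mul_self, mul_one, mul_assoc _ Dᴴ,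
            conjTranspose_mul_of_mem hDm, mul_one]
      _ = q • (weyl a * D) := by rw [hq, smul_mul_assoc, smul_mul_assoc, one_mul]

/-- A Clifford operator induces a symplectic transformation. -/
lemma exists_linearMap_of_conj {U : QMat m} (hU : U ∈ Matrix.unitaryGroup (Fin m → ZMod 2) ℂ)
    (h : ∀ b, ∃ a, ∃ c : ℂ, c ≠ 0 ∧ U * weyl b * Uᴴ = c • weyl a) :
    ∃ f : PVec m →ₗ[ZMod 2] PVec m, (∀ a b, sympl (f a) (f b) = sympl a b) ∧
      ∀ a, ∃ c : ℂ, c ≠ 0 ∧ U * weyl a * Uᴴ = c • weyl (f a) := by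
  choose f c hc hf using h
  have hadd : ∀ a b, f (a + b) = f a + f b := by
    intro a b
    have h1 := conj_mul_conj hU (weyl a) (weyl b)
    rw [hf, hf, smul_mul_smul_comm, weyl_mul (f a), weyl_mul a b, mul_smul_comm, smul_mul_assoc, hf,
      smul_smul, smul_smul] at h1
    have h2 := congrArg (fun X => (c a * c b * sgn (zPart (f b) ⬝ᵥ xPart (f a)))⁻¹ • X) h1
    rw [inv_smul_smul₀ (mul_ne_zero (mul_ne_zero (hc a) (hc b)) (sgn_ne_zero _)), smul_smul] at h2
    exact eq_of_smul_weyl_eq h2.symm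
  -- Additivity is linearity over `F_2`. The form is recovered from the commutation sign, which
  -- conjugation preserves.
  refine ⟨(AddMonoidHom.mk' f hadd).toZModLinearMap 2, fun a b => sgn_injective ?_,
    fun a => ⟨c a, hc a, hf a⟩⟩
  change sgn (sympl (f a) (f b)) = _
  have h1 := conj_mul_conj hU (weyl a) (weyl b)
  rw [weyl_mul_comm a b, mul_smul_comm, smul_mul_assoc, ← conj_mul_conj hU, hf, hf,
    smul_mul_smul_comm, smul_mul_smul_comm, mul_comm (c b),
    weyl_mul_comm (f a), smul_comm _ (c a * c b)] at h1
  have h2 := smul_right_injective _ (mul_ne_zero (hc a) (hc b)) h1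
  have h3 : weyl (f b) * weyl (f a) ≠ 0 := by
    rw [weyl_mul]; exact smul_ne_zero (sgn_ne_zero _) (weyl_ne_zero _)
  exact smul_left_injective ℂ h3 h2

lemma injective_of_sympl {f : PVec m →ₗ[ZMod 2] PVec m}
    (hf : ∀ a b, sympl (f a) (f b) = sympl a b) : Function.Injective f := by
  refine (injective_iff_map_eq_zero f).2 fun a ha => eq_zero_of_sympl_eq_zero fun b => ?_
  rw [← hf, ha, sympl_zero_left]

lemma surjective_of_sympl {f : PVec m →ₗ[ZMod 2] PVec m}
    (hf : ∀ a b, sympl (f a) (f b) = sympl a b) : Function.Surjective f :=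
  Finite.surjective_of_injective (injective_of_sympl hf)

lemma IsLagrangian.image {K : Set (PVec m)} (hK : IsLagrangian K) {f : PVec m →ₗ[ZMod 2] PVec m}
    (hf : ∀ a b, sympl (f a) (f b) = sympl a b) : IsLagrangian (f '' K) := by
  intro a
  obtain ⟨a, rfl⟩ := surjective_of_sympl hf a
  rw [(injective_of_sympl hf).mem_set_image, hK, Set.forall_mem_image]
  simp only [hf]

/-- Equivalent sets of bases of Pauli partitions are related by a symplectic transformation of
the partitions. -/
lemma exists_symplectic_of_isDiag {ι : Type*} [Nontrivial ι] {K L : ι → Set (PVec m)}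
    (hK : ∀ j, IsLagrangian (K j)) (hL : ∀ j, IsLagrangian (L j))
    (hcover : ∀ a, ∃ j, a ∈ K j) (hinter : ∀ i j, i ≠ j → ∀ a ∈ L i, a ∈ L j → a = 0)
    {U : QMat m} (hU : U ∈ Matrix.unitaryGroup (Fin m → ZMod 2) ℂ) {V V' : ι → QMat m}
    (hV : ∀ j, IsEigenbasis (K j) (V j)) (hV' : ∀ j, IsEigenbasis (L j) (V' j)) {W : ι → QMat m}
    (hW : ∀ j, IsMonomial (W j)) (h : ∀ j, V' j = U * V j * W j) :
    ∃ f : PVec m →ₗ[ZMod 2] PVec m, (∀ a b, sympl (f a) (f b) = sympl a b) ∧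
      ∀ j, L j = f '' K j := by
  -- Both operators are diagonal in `V' j`; for the first one this uses that monomial matrices
  -- preserve diagonality.
  have hcomm : ∀ j, ∀ a ∈ K j, ∀ b ∈ L j, Commute (U * weyl a * Uᴴ) (weyl b) := by
    intro j a ha b hb
    refine commute_of_isDiag (hV' j).1 ?_ ((hV' j).2 b hb)
    have : (V' j)ᴴ * (U * weyl a * Uᴴ) * V' j = (W j)ᴴ * ((V j)ᴴ * weyl a * V j) * W j := by
      rw [h j, Matrix.conjTranspose_mul, Matrix.conjTranspose_mul]
      calc (W j)ᴴ * ((V j)ᴴ * Uᴴ) * (U * weyl a * Uᴴ) * (U * V j * W j) =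
          (W j)ᴴ * ((V j)ᴴ * (Uᴴ * (U * weyl a * Uᴴ) * U) * V j) * W j := by
            simp only [mul_assoc]
        _ = _ := by rw [conjTranspose_conj_conj hU]
    rw [this]
    exact (hW j).isDiag_conj ((hV j).2 a ha)
  obtain ⟨f, hf, hfU⟩ := exists_linearMap_of_conj hU
    (exists_conj_eq_smul_weyl hK hL hcover hinter hU hcomm)
  refine ⟨f, hf, fun j => (((hK j).image hf).eq_of_subset (hL j) ?_).symm⟩
  rintro _ ⟨a, ha, rfl⟩
  refine (hL j _).2 fun b hb => ?_
  obtain ⟨c, hc, hca⟩ := hfU a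
  have := hcomm j a ha b hb
  rwa [hca, Commute.smul_left_iff₀ hc, weyl_commute_iff] at this

end CyclicMUB

/-! ### From symplectic matrices to unitaries, through generators -/

namespace CyclicMUB

variable {m : ℕ}

/-! ### Unitary matrices that implement stabilizer matrices -/

lemma implements_of_weyl {U : QMat m} (hU : U ∈ Matrix.unitaryGroup (Fin m → ZMod 2) ℂ)
    {C : SMat m} (h : ∀ a, ∃ c : ℂ, U * weyl a = c • (weyl (C *ᵥ a) * U)) : Implements U C := by
  intro a
  obtain ⟨c, hc⟩ := h a
  refine ⟨pauliPhase a * c * (pauliPhase (C *ᵥ a))⁻¹, ?_⟩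
  rw [pauli_eq_smul_weyl, pauli_eq_smul_weyl, smul_smul,
    inv_mul_cancel_right₀ (pauliPhase_ne_zero _), mul_smul_comm, smul_mul_assoc, hc,
    smul_mul_assoc, mul_assoc, mul_conjTranspose_of_mem hU, mul_one, smul_smul]

lemma Implements.conj_weyl {U : QMat m} (hU : U ∈ Matrix.unitaryGroup (Fin m → ZMod 2) ℂ)
    {C : SMat m} (h : Implements U C) (a : PVec m) :
    ∃ c : ℂ, c ≠ 0 ∧ U * weyl a * Uᴴ = c • weyl (C *ᵥ a) := by
  obtain ⟨c, hc⟩ := h a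
  rw [pauli_eq_smul_weyl, pauli_eq_smul_weyl, mul_smul_comm, smul_mul_assoc, smul_smul] at hc
  have h1 : U * weyl a * Uᴴ = ((pauliPhase a)⁻¹ * (c * pauliPhase (C *ᵥ a))) • weyl (C *ᵥ a) := by
    rw [mul_smul, ← hc, inv_smul_smul₀ (pauliPhase_ne_zero a)]
  refine ⟨_, fun h0 => weyl_ne_zero a ?_, h1⟩
  rw [h0, zero_smul] at h1
  rw [← conjTranspose_conj_conj hU (weyl a), h1, mul_zero, zero_mul]

lemma Implements.mul {U V : QMat m} {C D : SMat m} (hU : Implements U C) (hV : Implements V D) :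
    Implements (U * V) (C * D) := by
  intro a
  obtain ⟨c, hc⟩ := hV a
  obtain ⟨d, hd⟩ := hU (D *ᵥ a)
  refine ⟨c * d, ?_⟩
  calc U * V * pauli a * (U * V)ᴴ = U * (V * pauli a * Vᴴ) * Uᴴ := by
        rw [Matrix.conjTranspose_mul]; simp only [mul_assoc]
    _ = _ := by rw [hc, mul_smul_comm, smul_mul_assoc, hd, smul_smul, Matrix.mulVec_mulVec]

lemma Implements.one : Implements (1 : QMat m) 1 := fun a => ⟨1, by simp⟩

lemma Implements.pow {U : QMat m} {C : SMat m} (hU : Implements U C) (n : ℕ) :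
    Implements (U ^ n) (C ^ n) := by
  induction n with
  | zero => simpa using Implements.one
  | succ n ih => rw [pow_succ, pow_succ]; exact ih.mul hU

lemma Implements.smul {U : QMat m} {C : SMat m} (hU : Implements U C) (μ : ℂ) :
    Implements (μ • U) C := by
  intro a
  obtain ⟨c, hc⟩ := hU a
  refine ⟨μ * star μ * c, ?_⟩
  rw [Matrix.conjTranspose_smul, smul_mul_assoc, smul_mul_assoc, mul_smul_comm, hc, smul_smul,
    smul_smul, mul_assoc]

/-- The stabilizer matrices that are implemented by a unitary matrix. -/
def Implementable (C : SMat m) : Prop :=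
  ∃ U ∈ Matrix.unitaryGroup (Fin m → ZMod 2) ℂ, Implements U C

lemma Implementable.mul {C D : SMat m} (hC : Implementable C) (hD : Implementable D) :
    Implementable (C * D) := by
  obtain ⟨U, hU, hUC⟩ := hC
  obtain ⟨V, hV, hVD⟩ := hD
  exact ⟨U * V, mul_mem hU hV, hUC.mul hVD⟩

lemma pVec_eq_elim (a : PVec m) : Sum.elim (zPart a) (xPart a) = a := by
  funext i; rcases i with k | k <;> rfl

/-- Basis permutations implement the linear transformations of the qubits. -/
lemma implementable_diag {N W : Matrix (Fin m) (Fin m) (ZMod 2)} (h : Nᵀ * W = 1) :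
    Implementable (Matrix.fromBlocks N 0 0 W) := by
  have hW : W * Nᵀ = 1 := mul_eq_one_comm.1 h
  have hinj : ∀ x y, W *ᵥ x = W *ᵥ y → x = y := fun x y hxy => by
    have := congrArg (Nᵀ *ᵥ ·) hxy
    simpa [Matrix.mulVec_mulVec, h] using this
  let U : QMat m := Matrix.of fun x y => if x = W *ᵥ y then 1 else 0
  have hUa : ∀ x y, U x y = if x = W *ᵥ y then 1 else 0 := fun _ _ => rfl
  have hU : U ∈ Matrix.unitaryGroup (Fin m → ZMod 2) ℂ := by
    rw [Matrix.mem_unitaryGroup_iff', Matrix.star_eq_conjTranspose]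
    ext x y
    simp only [Matrix.mul_apply, Matrix.conjTranspose_apply, hUa, mul_ite, mul_one, mul_zero]
    rw [Finset.sum_ite_eq' Finset.univ (W *ᵥ y), if_pos (Finset.mem_univ _), Matrix.one_apply]
    by_cases hxy : x = y
    · simp [hxy]
    · rw [if_neg fun hh => hxy (hinj x y hh.symm), if_neg hxy, star_zero]
  refine ⟨U, hU, implements_of_weyl hU fun a => ⟨1, ?_⟩⟩
  obtain ⟨z, q, rfl⟩ : ∃ z q, a = Sum.elim z q := ⟨_, _, (pVec_eq_elim a).symm⟩
  have : Matrix.fromBlocks N 0 0 W *ᵥ Sum.elim z q = Sum.elim (N *ᵥ z) (W *ᵥ q) := by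
    rw [Matrix.fromBlocks_mulVec]
    simp
  rw [this, one_smul]
  ext x y
  simp only [Matrix.mul_apply, weyl_elim_apply, hUa, mul_ite, mul_zero, ite_mul, zero_mul, one_mul,
    mul_one]
  rw [Finset.sum_ite_eq' Finset.univ (y + q), Finset.sum_ite_eq' Finset.univ (W *ᵥ y)]
  simp only [Finset.mem_univ, if_true, Matrix.mulVec_add]
  split_ifs with hx
  · rw [hx, ← Matrix.mulVec_add, Matrix.dotProduct_mulVec, Matrix.vecMul_mulVec,
      ← Matrix.dotProduct_mulVec, h, Matrix.one_mulVec]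
  · rfl

/-- The Hadamard transform exchanges the `Z` and `X` parts. -/
lemma implementable_swap : Implementable (Matrix.fromBlocks 0 1 1 0 : SMat m) := by
  let s : ℂ := ((√((2 : ℝ) ^ m) : ℝ) : ℂ)⁻¹
  have hs : star s = s := by simp [s]
  have hss : s * s * (2 : ℂ) ^ m = 1 := by
    have h1 : ((√((2 : ℝ) ^ m) : ℝ) : ℂ) * ((√((2 : ℝ) ^ m) : ℝ) : ℂ) = (2 : ℂ) ^ m := by
      rw [← Complex.ofReal_mul, Real.mul_self_sqrt (by positivity)]
      push_cast; rfl
    have h2 : ((2 : ℂ) ^ m) ≠ 0 := pow_ne_zero _ two_ne_zero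
    rw [← mul_inv, h1, inv_mul_cancel₀ h2]
  let U : QMat m := Matrix.of fun x y => s * sgn (x ⬝ᵥ y)
  have hUa : ∀ x y, U x y = s * sgn (x ⬝ᵥ y) := fun _ _ => rfl
  have hU : U ∈ Matrix.unitaryGroup (Fin m → ZMod 2) ℂ := by
    rw [Matrix.mem_unitaryGroup_iff', Matrix.star_eq_conjTranspose]
    ext x y
    have : ∀ z, star (s * sgn (z ⬝ᵥ x)) * (s * sgn (z ⬝ᵥ y)) = s * s * sgn (z ⬝ᵥ (x + y)) := by
      intro z
      rw [star_mul', star_sgn, hs, dotProduct_add, sgn_add]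
      ring
    simp only [Matrix.mul_apply, Matrix.conjTranspose_apply, hUa, this]
    rw [← Finset.mul_sum, sum_sgn_dotProduct, Fintype.card_fin, Matrix.one_apply]
    by_cases hxy : x = y
    · rw [if_pos (by rw [hxy, pi_add_self]), if_pos hxy, hss]
    · rw [if_neg fun hh => hxy (pi_eq_of_add_eq_zero hh), if_neg hxy, mul_zero]
  refine ⟨U, hU, implements_of_weyl hU fun a => ?_⟩
  obtain ⟨z, q, rfl⟩ : ∃ z q, a = Sum.elim z q := ⟨_, _, (pVec_eq_elim a).symm⟩
  refine ⟨sgn (z ⬝ᵥ q), ?_⟩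
  have : Matrix.fromBlocks (0 : Matrix (Fin m) (Fin m) (ZMod 2)) 1 1 0 *ᵥ Sum.elim z q =
      Sum.elim q z := by
    rw [Matrix.fromBlocks_mulVec]
    simp
  rw [this]
  ext x y
  have hx : ∀ j, (x = j + z) ↔ (j = x + z) := fun j =>
    ⟨fun h => by rw [h, add_assoc, pi_add_self, add_zero],
      fun h => by rw [h, add_assoc, pi_add_self, add_zero]⟩
  simp only [Matrix.mul_apply, Matrix.smul_apply, weyl_elim_apply, hUa, mul_ite, mul_zero, ite_mul,
    zero_mul, hx, smul_eq_mul]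
  rw [Finset.sum_ite_eq' Finset.univ (y + q), Finset.sum_ite_eq' Finset.univ (x + z)]
  simp only [Finset.mem_univ, if_true, add_dotProduct, dotProduct_add, sgn_add]
  rw [dotProduct_comm q x]
  ring

/-- The strictly lower triangular part of a matrix. -/
def strictLower (S : Matrix (Fin m) (Fin m) (ZMod 2)) : Matrix (Fin m) (Fin m) (ZMod 2) :=
  Matrix.of fun i j => if j < i then S i j else 0

/-- In characteristic two the diagonal cannot be halved, so it is split off; it will require fourth
roots of unity. -/
lemma eq_strictLower_add {S : Matrix (Fin m) (Fin m) (ZMod 2)} (hS : S.IsSymm) :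
    S = strictLower S + (strictLower S)ᵀ + Matrix.diagonal S.diag := by
  ext i j
  rcases lt_trichotomy i j with h | rfl | h
  · simp [strictLower, h, h.not_gt, h.ne, hS.apply i j]
  · simp [strictLower]
  · simp [strictLower, h, h.not_gt, h.ne']

/-- The carry `1 + 1 = 2`, lost modulo two, accounts for the sign `I ^ 2 = -1`. -/
lemma I_pow_val_add (s t : ZMod 2) :
    Complex.I ^ (s + t).val = Complex.I ^ s.val * Complex.I ^ t.val * sgn (s * t) := by
  have h : (1 + 1 : ZMod 2) = 0 := by decide
  rcases zmod_two_cases s with rfl | rfl <;> rcases zmod_two_cases t with rfl | rfl <;>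
    simp [h, ZMod.val_one]

/-- Symmetric matrices have quadratic phase functions. -/
lemma exists_quadratic_phase {S : Matrix (Fin m) (Fin m) (ZMod 2)} (hS : S.IsSymm) :
    ∃ ψ : (Fin m → ZMod 2) → ℂ, (∀ x, star (ψ x) * ψ x = 1) ∧
      ∀ x y, ψ (x + y) = ψ x * ψ y * sgn (x ⬝ᵥ S *ᵥ y) := by
  -- The strictly lower part polarizes to the off-diagonal entries of `S`. The diagonal ones are the
  -- polarization of no `F_2`-valued quadratic form, and powers of `I` supply them.
  refine ⟨fun x => (∏ k, Complex.I ^ (S k k * x k).val) * sgn (x ⬝ᵥ strictLower S *ᵥ x), ?_, ?_⟩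
  · intro x
    have h1 : star (∏ k, Complex.I ^ (S k k * x k).val) * (∏ k, Complex.I ^ (S k k * x k).val) =
        1 := by
      rw [star_prod, ← Finset.prod_mul_distrib]
      refine Finset.prod_eq_one fun k _ => ?_
      rw [star_pow, ← mul_pow]
      simp
    rw [star_mul', star_sgn]
    linear_combination (sgn (x ⬝ᵥ strictLower S *ᵥ x) * sgn (x ⬝ᵥ strictLower S *ᵥ x)) * h1 +
      sgn_mul_self (x ⬝ᵥ strictLower S *ᵥ x)
  · intro x y
    have h1 : ∏ k, Complex.I ^ (S k k * (x + y) k).val = (∏ k, Complex.I ^ (S k k * x k).val) *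
        (∏ k, Complex.I ^ (S k k * y k).val) * sgn (x ⬝ᵥ Matrix.diagonal S.diag *ᵥ y) := by
      rw [dotProduct, sgn_sum, ← Finset.prod_mul_distrib, ← Finset.prod_mul_distrib]
      refine Finset.prod_congr rfl fun k _ => ?_
      rw [Pi.add_apply, mul_add, I_pow_val_add, Matrix.mulVec_diagonal, Matrix.diag]
      congr 2
      rcases zmod_two_cases (S k k) with h | h <;> simp [h]
    have h2 : x ⬝ᵥ S *ᵥ y = x ⬝ᵥ strictLower S *ᵥ y + y ⬝ᵥ strictLower S *ᵥ x +
        x ⬝ᵥ Matrix.diagonal S.diag *ᵥ y := by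
      conv_lhs => rw [eq_strictLower_add hS]
      rw [Matrix.add_mulVec, Matrix.add_mulVec, dotProduct_add, dotProduct_add,
        Matrix.dotProduct_mulVec x (strictLower S)ᵀ, Matrix.vecMul_transpose,
        dotProduct_comm (strictLower S *ᵥ x)]
    beta_reduce
    rw [h1, h2, Matrix.mulVec_add, dotProduct_add, add_dotProduct, add_dotProduct]
    simp only [sgn_add]
    ring

/-- Quadratic phases implement the shears. -/
lemma implementable_shear {S : Matrix (Fin m) (Fin m) (ZMod 2)} (hS : S.IsSymm) :
    Implementable (Matrix.fromBlocks 1 S 0 1) := by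
  obtain ⟨ψ, hψ, hψadd⟩ := exists_quadratic_phase hS
  have hU : Matrix.diagonal ψ ∈ Matrix.unitaryGroup (Fin m → ZMod 2) ℂ := by
    rw [Matrix.mem_unitaryGroup_iff', Matrix.star_eq_conjTranspose, Matrix.diagonal_conjTranspose,
      Matrix.diagonal_mul_diagonal, ← Matrix.diagonal_one]
    congr 1
    funext x
    exact hψ x
  refine ⟨Matrix.diagonal ψ, hU, implements_of_weyl hU fun a => ?_⟩
  obtain ⟨z, q, rfl⟩ : ∃ z q, a = Sum.elim z q := ⟨_, _, (pVec_eq_elim a).symm⟩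
  refine ⟨ψ q * sgn (q ⬝ᵥ S *ᵥ q), ?_⟩
  have : Matrix.fromBlocks 1 S 0 1 *ᵥ Sum.elim z q = Sum.elim (z + S *ᵥ q) q := by
    rw [Matrix.fromBlocks_mulVec]
    simp
  rw [this]
  ext x y
  rw [Matrix.diagonal_mul, Matrix.smul_apply, Matrix.mul_diagonal, weyl_elim_apply,
    weyl_elim_apply, smul_eq_mul]
  split_ifs with hx
  · rw [hx, hψadd]
    simp only [add_dotProduct, dotProduct_add, sgn_add]
    rw [dotProduct_comm (S *ᵥ q) y, dotProduct_comm (S *ᵥ q) q]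
    have := sgn_mul_self (q ⬝ᵥ S *ᵥ q)
    linear_combination -(ψ q * sgn (y ⬝ᵥ S *ᵥ q) * ψ y * sgn (z ⬝ᵥ y) * sgn (z ⬝ᵥ q)) * this
  · simp

lemma Implements.isEigenbasis {U : QMat m} (hU : U ∈ Matrix.unitaryGroup (Fin m → ZMod 2) ℂ)
    {C : SMat m} (hC : Implements U C) {K : Set (PVec m)} {V : QMat m} (hV : IsEigenbasis K V) :
    IsEigenbasis ((C *ᵥ ·) '' K) (U * V) := by
  refine ⟨mul_mem hU hV.1, ?_⟩
  rintro _ ⟨a, ha, rfl⟩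
  obtain ⟨c, hc, hca⟩ := hC.conj_weyl hU a
  have h1 : weyl (C *ᵥ a) = c⁻¹ • (U * weyl a * Uᴴ) := by rw [hca, inv_smul_smul₀ hc]
  have h2 : (U * V)ᴴ * (U * weyl a * Uᴴ) * (U * V) = Vᴴ * weyl a * V := by
    rw [Matrix.conjTranspose_mul]
    calc Vᴴ * Uᴴ * (U * weyl a * Uᴴ) * (U * V) = Vᴴ * (Uᴴ * (U * weyl a * Uᴴ) * U) * V := by
          simp only [mul_assoc]
      _ = _ := by rw [conjTranspose_conj_conj hU]
  simp only
  rw [h1, mul_smul_comm, smul_mul_assoc, h2]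
  exact (hV.2 a ha).smul _

/-- The standard basis consists of eigenvectors of the operators of `Z` type. -/
lemma isEigenbasis_one : IsEigenbasis (Set.range fun c : Fin m → ZMod 2 => genZero m *ᵥ c) 1 := by
  refine ⟨one_mem _, ?_⟩
  rintro _ ⟨c, rfl⟩ x y hxy
  have : (genZero m *ᵥ c : PVec m) = Sum.elim c 0 := by simp [genZero, Matrix.fromRows_mulVec]
  simp only
  rw [Matrix.conjTranspose_one, one_mul, mul_one, this, weyl_elim_apply, add_zero, if_neg hxy]

end CyclicMUB

/-! ### The field generated by a matrix, and Fibonacci polynomials in it -/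

namespace CyclicMUB

variable {m : ℕ}

open Polynomial

/-! ### Matrices annihilated by an irreducible polynomial -/

section Annihilated

variable {F : Type*} [Field F] {n : Type*} [Fintype n] [DecidableEq n]

/-- A Bézout relation between `p` and `f`, evaluated at `Y`, inverts `f(Y)`. -/
lemma isUnit_aeval {p f : F[X]} (hp : Irreducible p) {Y : Matrix n n F} (hY : aeval Y p = 0)
    (hf : ¬ p ∣ f) : IsUnit (aeval Y f) := by
  obtain ⟨s, t, h⟩ := (hp.coprime_iff_not_dvd).2 hf
  have h1 : aeval Y t * aeval Y f = 1 := by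
    rw [← map_mul, ← map_one (aeval (R := F) Y), ← h, map_add, map_mul _ s, hY, mul_zero, zero_add]
  exact (Matrix.isUnit_iff_isUnit_det _).2 (Matrix.isUnit_det_of_left_inverse h1)

lemma aeval_mulVec_eq_zero_iff {p f : F[X]} (hp : Irreducible p) {Y : Matrix n n F}
    (hY : aeval Y p = 0) {v : n → F} (hv : v ≠ 0) : aeval Y f *ᵥ v = 0 ↔ p ∣ f := by
  constructor
  · intro h
    by_contra hf
    obtain ⟨u, hu⟩ := isUnit_aeval hp hY hf
    apply hv
    rw [← Matrix.one_mulVec v, ← u.inv_mul, ← Matrix.mulVec_mulVec, hu, h, Matrix.mulVec_zero]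
  · rintro ⟨g, rfl⟩
    rw [map_mul, hY, zero_mul, Matrix.zero_mulVec]

/-- The map `f ↦ f(Y) v`. -/
noncomputable def polyMulVec (Y : Matrix n n F) (v : n → F) : F[X] →ₗ[F] n → F where
  toFun f := aeval Y f *ᵥ v
  map_add' f g := by rw [map_add, Matrix.add_mulVec]
  map_smul' c f := by rw [map_smul, Matrix.smul_mulVec]; rfl

@[simp] lemma polyMulVec_apply (Y : Matrix n n F) (v : n → F) (f : F[X]) :
    polyMulVec Y v f = aeval Y f *ᵥ v := rfl

/-- The algebra generated by `Y` acts transitively on the nonzero vectors. -/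
lemma polyMulVec_surjective {p : F[X]} (hp : Irreducible p) {Y : Matrix n n F}
    (hY : aeval Y p = 0) (hd : p.natDegree = Fintype.card n) {v : n → F} (hv : v ≠ 0) :
    Function.Surjective (polyMulVec Y v) := by
  -- On polynomials of degree below `deg p` the map is injective, and the dimensions agree.
  set g := (polyMulVec Y v).comp (degreeLT F (Fintype.card n)).subtype
  have hinj : Function.Injective g := by
    refine (injective_iff_map_eq_zero g).2 fun f hf => ?_
    have h1 := (aeval_mulVec_eq_zero_iff hp hY hv).1 hf
    have h2 : degree (f : F[X]) < degree p := by
      rw [degree_eq_natDegree hp.ne_zero, hd]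
      exact mem_degreeLT.1 f.2
    exact Subtype.ext (eq_zero_of_dvd_of_degree_lt h1 h2)
  have hfr : Module.finrank F (degreeLT F (Fintype.card n)) = Module.finrank F (n → F) := by
    rw [(degreeLTEquiv F _).finrank_eq, Module.finrank_fin_fun, Module.finrank_fintype_fun_eq_card]
  have : Module.Finite F (degreeLT F (Fintype.card n)) :=
    Module.Finite.equiv (degreeLTEquiv F _).symm
  have hs := (LinearMap.injective_iff_surjective_of_finrank_eq_finrank hfr).1 hinj
  intro w
  obtain ⟨f, hf⟩ := hs w
  exact ⟨f, hf⟩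

/-- Matrices annihilated by the same irreducible polynomial of maximal degree are similar. -/
lemma exists_similar [Nonempty n] {p : F[X]} (hp : Irreducible p)
    (hd : p.natDegree = Fintype.card n) {Y Y' : Matrix n n F} (hY : aeval Y p = 0)
    (hY' : aeval Y' p = 0) : ∃ N : Matrix n n F, IsUnit N ∧ N * Y = Y' * N := by
  set u : n → F := Pi.single (Classical.arbitrary n) 1
  have hu : u ≠ 0 := by
    intro h
    have := congrFun h (Classical.arbitrary n)
    simp [u] at this
  have hs := polyMulVec_surjective hp hY hd hu
  have hs' := polyMulVec_surjective hp hY' hd hu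
  have hker : LinearMap.ker (polyMulVec Y u) = LinearMap.ker (polyMulVec Y' u) := by
    ext f
    rw [LinearMap.mem_ker, LinearMap.mem_ker, polyMulVec_apply, polyMulVec_apply,
      aeval_mulVec_eq_zero_iff hp hY hu, aeval_mulVec_eq_zero_iff hp hY' hu]
  -- Both actions make the space cyclic over `F[X]` with the same annihilator `(p)`; the intertwiner
  -- sends `f(Y) u` to `f(Y') u`.
  let e : (n → F) ≃ₗ[F] (n → F) := ((polyMulVec Y u).quotKerEquivOfSurjective hs).symm ≪≫ₗ
    Submodule.quotEquivOfEq _ _ hker ≪≫ₗ (polyMulVec Y' u).quotKerEquivOfSurjective hs'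
  have he : ∀ f : F[X], e (aeval Y f *ᵥ u) = aeval Y' f *ᵥ u := by
    intro f
    have : ((polyMulVec Y u).quotKerEquivOfSurjective hs).symm (aeval Y f *ᵥ u) =
        Submodule.Quotient.mk f := by
      rw [LinearEquiv.symm_apply_eq]; rfl
    simp only [e, LinearEquiv.trans_apply, this, Submodule.quotEquivOfEq_mk]
    rfl
  have hN : ∀ w, LinearMap.toMatrix' (e : (n → F) →ₗ[F] (n → F)) *ᵥ w = e w := fun w => by
    rw [LinearMap.toMatrix'_mulVec]; rfl
  refine ⟨LinearMap.toMatrix' (e : (n → F) →ₗ[F] (n → F)), ?_, ?_⟩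
  · refine (Matrix.isUnit_iff_isUnit_det _).2 (Matrix.isUnit_det_of_left_inverse
      (B := LinearMap.toMatrix' (e.symm : (n → F) →ₗ[F] (n → F))) ?_)
    rw [← LinearMap.toMatrix'_comp]
    simp
  · refine Matrix.ext_of_mulVec_single fun i => ?_
    generalize (Pi.single i 1 : n → F) = w
    obtain ⟨f, rfl⟩ := hs w
    rw [← Matrix.mulVec_mulVec, ← Matrix.mulVec_mulVec, hN, hN, polyMulVec_apply, he,
      Matrix.mulVec_mulVec, Matrix.mulVec_mulVec]
    have h1 : Y * aeval Y f = aeval Y (X * f) := by rw [map_mul, aeval_X]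
    have h2 : Y' * aeval Y' f = aeval Y' (X * f) := by rw [map_mul, aeval_X]
    rw [h1, h2, he]

lemma semiconjBy_aeval {N Y Y' : Matrix n n F} (h : SemiconjBy N Y Y') (f : F[X]) :
    SemiconjBy N (aeval Y f) (aeval Y' f) := by
  induction f using Polynomial.induction_on' with
  | add f g hf hg => rw [map_add, map_add]; exact hf.add_right hg
  | monomial k a =>
    rw [aeval_monomial, aeval_monomial]
    exact SemiconjBy.mul_right (Algebra.commutes a N).symm (h.pow_right k)

lemma transpose_aeval (Y : Matrix n n F) (f : F[X]) : (aeval Y f)ᵀ = aeval Yᵀ f := by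
  induction f using Polynomial.induction_on' with
  | add f g hf hg => rw [map_add, map_add, Matrix.transpose_add, hf, hg]
  | monomial k a =>
    rw [aeval_monomial, aeval_monomial, Matrix.transpose_mul, Matrix.transpose_pow,
      Matrix.algebraMap_eq_diagonal, Matrix.diagonal_transpose, ← Matrix.algebraMap_eq_diagonal,
      Algebra.commutes]

end Annihilated

/-- An irreducible polynomial over a finite field has a root in each extension by an irreducible
polynomial of the same degree. -/
lemma exists_dvd_comp {F : Type*} [Field F] [Finite F] {p q : F[X]} (hp : Irreducible p)
    (hq : Irreducible q) (h : p.natDegree = q.natDegree) : ∃ f, q ∣ p.comp f := by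
  have := Fact.mk hp
  have := Fact.mk hq
  have : Module.Finite F (AdjoinRoot p) :=
    Module.Finite.of_basis (AdjoinRoot.powerBasis hp.ne_zero).basis
  have : Module.Finite F (AdjoinRoot q) :=
    Module.Finite.of_basis (AdjoinRoot.powerBasis hq.ne_zero).basis
  have : Finite (AdjoinRoot p) := Module.finite_of_finite F
  have : Finite (AdjoinRoot q) := Module.finite_of_finite F
  have hfr : Module.finrank F (AdjoinRoot p) = Module.finrank F (AdjoinRoot q) := by
    rw [(AdjoinRoot.powerBasis hp.ne_zero).finrank, (AdjoinRoot.powerBasis hq.ne_zero).finrank,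
      AdjoinRoot.powerBasis_dim, AdjoinRoot.powerBasis_dim, h]
  -- An embedding of finite fields of equal degree sends the root of `p` to the class of some
  -- polynomial `f` modulo `q`.
  obtain ⟨φ⟩ := FiniteField.nonempty_algHom_of_finrank_dvd (F := F) (dvd_of_eq hfr)
  obtain ⟨f, hf⟩ := AdjoinRoot.mk_surjective (φ (AdjoinRoot.root p))
  refine ⟨f, ?_⟩
  rw [← AdjoinRoot.mk_eq_zero, ← AdjoinRoot.aeval_eq, aeval_comp, AdjoinRoot.aeval_eq, hf,
    aeval_algHom_apply, AdjoinRoot.aeval_eq, AdjoinRoot.mk_self, map_zero]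

/-! ### Fibonacci polynomials modulo an irreducible polynomial -/

lemma fibPoly_add_two (K : Type*) [Field K] (n : ℕ) :
    fibPoly K (n + 2) = X * fibPoly K (n + 1) + fibPoly K n := rfl

/-- Cassini's identity; its alternating sign disappears in characteristic two. -/
lemma fibPoly_mul_add_sq (n : ℕ) :
    fibPoly (ZMod 2) (n + 2) * fibPoly (ZMod 2) n + fibPoly (ZMod 2) (n + 1) ^ 2 = 1 := by
  induction n with
  | zero => simp [fibPoly]
  | succ n ih =>
    rw [fibPoly_add_two _ (n + 1)]
    rw [← ih]
    have h2 : (2 : (ZMod 2)[X]) = 0 := CharTwo.two_eq_zero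
    rw [fibPoly_add_two _ n]
    linear_combination (X * fibPoly (ZMod 2) (n + 1) * (X * fibPoly (ZMod 2) (n + 1) +
      fibPoly (ZMod 2) n)) * h2

/-- Modulo `p` the recursion gives `F_{n+2} = F_n`, so Cassini's identity reads `F_n ^ 2 = 1`, that
is, `(F_n - 1) ^ 2 = 0`. -/
lemma dvd_fibPoly_sub_one {p : (ZMod 2)[X]} (hp : Irreducible p) {n : ℕ}
    (h : p ∣ fibPoly (ZMod 2) (n + 1)) : p ∣ fibPoly (ZMod 2) n - 1 := by
  refine hp.prime.dvd_of_dvd_pow (n := 2) ?_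
  have h1 := fibPoly_mul_add_sq n
  rw [fibPoly_add_two] at h1
  have h2 : (2 : (ZMod 2)[X]) = 0 := CharTwo.two_eq_zero
  have h3 : (fibPoly (ZMod 2) n - 1) ^ 2 = fibPoly (ZMod 2) (n + 1) *
      (-(X * fibPoly (ZMod 2) n) - fibPoly (ZMod 2) (n + 1)) := by
    linear_combination h1 + (1 - fibPoly (ZMod 2) n) * h2
  rw [h3]
  exact h.mul_right _

end CyclicMUB

/-! ### The classes of an admissible stabilizer matrix form a partition -/

namespace CyclicMUB

variable {m : ℕ}

open Polynomial

/-! ### Pauli partitions -/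

section Partition

variable {K L : Fin (2 ^ m + 1) → Set (PVec m)}

lemma IsPauliPartition.isLagrangian (hK : IsPauliPartition K) (j : Fin (2 ^ m + 1)) :
    IsLagrangian (K j) :=
  isLagrangian_of_ncard (fun a ha b hb => (pauli_commute_iff a b).1 (hK.commute j a ha b hb))
    (hK.card_eq j)

lemma IsPauliPartition.exists_mem (hK : IsPauliPartition K) (a : PVec m) : ∃ j, a ∈ K j := by
  rcases eq_or_ne a 0 with rfl | ha
  · exact ⟨0, hK.zero_mem 0⟩
  · exact (hK.existsUnique a ha).exists

lemma IsPauliPartition.eq_zero_of_mem (hK : IsPauliPartition K) {i j : Fin (2 ^ m + 1)}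
    (hij : i ≠ j) {a : PVec m} (hi : a ∈ K i) (hj : a ∈ K j) : a = 0 :=
  by_contra fun ha => hij ((hK.existsUnique a ha).unique hi hj)

lemma IsPauliPartition.exists_ne_zero (hm : 0 < m) (hK : IsPauliPartition K)
    (j : Fin (2 ^ m + 1)) : ∃ a ∈ K j, a ≠ 0 := by
  refine Set.exists_ne_of_one_lt_ncard ?_ 0
  rw [hK.card_eq]
  exact Nat.one_lt_two_pow hm.ne'

lemma IsPauliPartition.isCompleteMUB (hK : IsPauliPartition K) {𝓑 : Fin (2 ^ m + 1) → QMat m}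
    (h𝓑 : IsEigenbasisFamily K 𝓑) : IsCompleteMUB 𝓑 := by
  rw [isEigenbasisFamily_iff] at h𝓑
  exact ⟨fun j => (h𝓑 j).1, fun i j hij => mutuallyUnbiased_of_inter (hK.isLagrangian i)
    (hK.isLagrangian j) (fun _ hi hj => hK.eq_zero_of_mem hij hi hj) (h𝓑 i) (h𝓑 j)⟩

/-- Pauli partitions whose classes are equal or have trivial intersection agree up to the order. -/
lemma IsPauliPartition.exists_perm (hm : 0 < m) (hK : IsPauliPartition K)
    (hL : IsPauliPartition L) (h : ∀ i j, ∀ a, a ≠ 0 → a ∈ K i → a ∈ L j → K i = L j) :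
    ∃ π : Equiv.Perm (Fin (2 ^ m + 1)), ∀ j, K j = L (π j) := by
  have : ∀ i, ∃ j, K i = L j := by
    intro i
    obtain ⟨a, ha, ha0⟩ := hK.exists_ne_zero hm i
    obtain ⟨j, hj⟩ := hL.exists_mem a
    exact ⟨j, h i j a ha0 ha hj⟩
  choose π hπ using this
  have hinj : Function.Injective π := by
    intro i j hij
    by_contra hne
    obtain ⟨a, ha, ha0⟩ := hK.exists_ne_zero hm i
    exact ha0 (hK.eq_zero_of_mem hne ha (by rw [hπ j, ← hij, ← hπ i]; exact ha))
  exact ⟨Equiv.ofBijective π (Finite.injective_iff_bijective.1 hinj), hπ⟩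

end Partition

/-! ### Semigroup-based stabilizer matrices -/

section Semigroup

variable {A R B : Matrix (Fin m) (Fin m) (ZMod 2)}

lemma IsSemigroupParam.mul_inv (h : IsSemigroupParam A R B) : R * R⁻¹ = 1 :=
  Matrix.mul_nonsing_inv _ ((Matrix.isUnit_iff_isUnit_det _).1 h.isUnit_R)

lemma IsSemigroupParam.inv_mul (h : IsSemigroupParam A R B) : R⁻¹ * R = 1 :=
  Matrix.nonsing_inv_mul _ ((Matrix.isUnit_iff_isUnit_det _).1 h.isUnit_R)

/-- In characteristic two the `A`-shear is its own inverse, so `C` is the conjugate by it of `(B R ;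
R⁻¹ 0)`, which is a `BR`-shear times a swap times a linear change of the qubits. Symmetry of `A`,
`R` and `BR` makes every factor implementable. -/
lemma IsSemigroupParam.implementable (h : IsSemigroupParam A R B) :
    Implementable (semigroupStabilizer A R B) := by
  have h1 : semigroupStabilizer A R B = Matrix.fromBlocks 1 A 0 1 *
      (Matrix.fromBlocks 1 (B * R) 0 1 * (Matrix.fromBlocks 0 1 1 0 *
        (Matrix.fromBlocks R⁻¹ 0 0 R * Matrix.fromBlocks 1 A 0 1))) := by
    simp only [semigroupStabilizer, Matrix.fromBlocks_multiply, mul_one, one_mul, mul_zero,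
      zero_mul, add_zero, zero_add]
    have h2 : B * R * R⁻¹ = B := by rw [mul_assoc, h.mul_inv, mul_one]
    rw [h2]
    congr 1
    rw [← mul_assoc (B * R), h2, ← mul_assoc A R⁻¹ A]
  rw [h1]
  refine (implementable_shear h.isSymm_A).mul ((implementable_shear h.isSymm_BR).mul
    (implementable_swap.mul ((implementable_diag ?_).mul (implementable_shear h.isSymm_A))))
  rw [Matrix.transpose_nonsing_inv, h.isSymm_R.eq, h.inv_mul]

lemma Implements.sympl_mulVec {U : QMat m} (hU : U ∈ Matrix.unitaryGroup (Fin m → ZMod 2) ℂ)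
    {C : SMat m} (hC : Implements U C) (a b : PVec m) : sympl (C *ᵥ a) (C *ᵥ b) = sympl a b := by
  have h := hC.conj_weyl hU
  obtain ⟨f, hf, hfU⟩ := exists_linearMap_of_conj hU fun b => ⟨_, h b⟩
  have : ∀ a, f a = C *ᵥ a := by
    intro a
    obtain ⟨c, hc, hca⟩ := h a
    obtain ⟨d, hd, hda⟩ := hfU a
    refine eq_of_smul_weyl_eq (c := c⁻¹ * d) ?_
    rw [mul_smul, ← hda, hca, inv_smul_smul₀ hc]
  rw [← this, ← this, hf]

lemma mulVec_injective_of_sympl {C : SMat m}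
    (hC : ∀ a b, sympl (C *ᵥ a) (C *ᵥ b) = sympl a b) : Function.Injective (C *ᵥ ·) :=
  injective_of_sympl (f := Matrix.mulVecLin C) hC

/-- The vectors of `Z` type. -/
abbrev zVec (c : Fin m → ZMod 2) : PVec m := Sum.elim c 0

lemma genZero_mulVec (c : Fin m → ZMod 2) : (genZero m *ᵥ c : PVec m) = zVec c := by
  simp [genZero, Matrix.fromRows_mulVec]

lemma mem_cyclicClasses {C : SMat m} {j : Fin (2 ^ m + 1)} {a : PVec m} :
    a ∈ cyclicClasses C j ↔ ∃ c, C ^ (j : ℕ) *ᵥ zVec c = a := by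
  simp only [cyclicClasses, Set.mem_range, ← Matrix.mulVec_mulVec, genZero_mulVec]

/-- The matrix polynomials `F j (B)` of the Fibonacci polynomials. -/
noncomputable abbrev fibMat (B : Matrix (Fin m) (Fin m) (ZMod 2)) (n : ℕ) : Matrix (Fin m) (Fin m) (ZMod 2) :=
  aeval B (fibPoly (ZMod 2) n)

lemma fibMat_add_two (n : ℕ) : fibMat B (n + 2) = B * fibMat B (n + 1) + fibMat B n := by
  rw [fibMat, fibPoly_add_two, map_add, map_mul, aeval_X]

/-- In the coordinates `(x, y)` used here, `C` becomes the companion map `(x, y) ↦ (B x + y, x)` of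
the Fibonacci recursion. -/
lemma semigroupStabilizer_mulVec (h : IsSemigroupParam A R B) (x y : Fin m → ZMod 2) :
    semigroupStabilizer A R B *ᵥ (Sum.elim (x + (A * R⁻¹) *ᵥ y) (R⁻¹ *ᵥ y)) =
      Sum.elim (B *ᵥ x + y + (A * R⁻¹) *ᵥ x) (R⁻¹ *ᵥ x) := by
  rw [semigroupStabilizer, Matrix.fromBlocks_mulVec]
  simp only [Sum.elim_comp_inl, Sum.elim_comp_inr, Matrix.mulVec_add, Matrix.mulVec_mulVec, add_mul,
    Matrix.add_mulVec, h.mul_inv, Matrix.one_mulVec, ← mul_assoc]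
  congr 1
  · linear_combination pi_add_self ((B * A * R⁻¹) *ᵥ y) + pi_add_self ((A * R⁻¹ * A * R⁻¹) *ᵥ y)
  · linear_combination pi_add_self ((R⁻¹ * A * R⁻¹) *ᵥ y)

lemma semigroupStabilizer_pow_mulVec (h : IsSemigroupParam A R B) (n : ℕ) (c : Fin m → ZMod 2) :
    semigroupStabilizer A R B ^ n *ᵥ zVec c =
      Sum.elim (fibMat B (n + 1) *ᵥ c + (A * R⁻¹) *ᵥ (fibMat B n *ᵥ c))
        (R⁻¹ *ᵥ (fibMat B n *ᵥ c)) := by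
  induction n with
  | zero => simp [fibMat, fibPoly]
  | succ n ih =>
    rw [pow_succ', ← Matrix.mulVec_mulVec, ih, semigroupStabilizer_mulVec h, fibMat_add_two,
      Matrix.add_mulVec, Matrix.mulVec_mulVec]

lemma IsSemigroupParam.natDegree (_ : IsSemigroupParam A R B) : B.charpoly.natDegree = m := by
  rw [Matrix.charpoly_natDegree_eq_dim, Fintype.card_fin]

/-- With `d = 2 ^ m`, the index gives `F_{d+1}(B) = 0`, and Cassini's identity gives `F_d(B) = 1`,
whence `F_{d+2}(B) = 1`. -/
lemma IsSemigroupParam.pow_mulVec_zVec (h : IsSemigroupParam A R B) (c : Fin m → ZMod 2) :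
    semigroupStabilizer A R B ^ (2 ^ m + 1) *ᵥ zVec c = zVec c := by
  have hB := Matrix.aeval_self_charpoly B
  have h1 : fibMat B (2 ^ m + 1) = 0 := by
    obtain ⟨g, hg⟩ := h.index.2.1.2
    rw [fibMat, hg, map_mul, hB, zero_mul]
  have h2 : fibMat B (2 ^ m) = 1 := by
    obtain ⟨g, hg⟩ := dvd_fibPoly_sub_one h.index.1 h.index.2.1.2
    have := congrArg (aeval B) hg
    rw [map_mul, hB, zero_mul, map_sub, map_one, sub_eq_zero] at this
    exact this
  rw [semigroupStabilizer_pow_mulVec h, fibMat_add_two, h1, h2]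
  simp

/-- After cancelling `C ^ j`, the vector `C ^ n (c' ; 0)` is of `Z` type, so `F_n(B) c' = 0` and the
characteristic polynomial divides `F_n`. As `n` is below the index, `n = 0`. -/
lemma IsSemigroupParam.eq_of_pow_mulVec_eq (h : IsSemigroupParam A R B) {j k : ℕ} (hjk : j ≤ k)
    (hk : k ≤ 2 ^ m) {c c' : Fin m → ZMod 2} (hc' : c' ≠ 0)
    (he : semigroupStabilizer A R B ^ j *ᵥ zVec c = semigroupStabilizer A R B ^ k *ᵥ zVec c') :
    j = k ∧ c = c' := by
  obtain ⟨n, rfl⟩ := Nat.exists_eq_add_of_le hjk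
  have hinj : Function.Injective ((semigroupStabilizer A R B ^ j) *ᵥ ·) := by
    obtain ⟨U, hU, hUC⟩ := h.implementable
    exact mulVec_injective_of_sympl ((hUC.pow j).sympl_mulVec (pow_mem hU j))
  rw [pow_add, ← Matrix.mulVec_mulVec] at he
  have he := hinj he
  rw [semigroupStabilizer_pow_mulVec h] at he
  have h1 : R⁻¹ *ᵥ (fibMat B n *ᵥ c') = 0 := by
    funext i
    exact (congrFun he (Sum.inr i)).symm
  have h2 : fibMat B n *ᵥ c' = 0 := by
    rw [← Matrix.one_mulVec (fibMat B n *ᵥ c'), ← h.mul_inv, ← Matrix.mulVec_mulVec, h1,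
      Matrix.mulVec_zero]
  have h3 := (aeval_mulVec_eq_zero_iff h.index.1 (Matrix.aeval_self_charpoly B) hc').1 h2
  have hn : n = 0 := by
    by_contra hn
    have := h.index.2.2 ⟨Nat.pos_of_ne_zero hn, h3⟩
    omega
  subst hn
  refine ⟨rfl, ?_⟩
  funext i
  simpa [fibMat, fibPoly] using congrFun he (Sum.inl i)

lemma IsSemigroupParam.isPauliPartition (h : IsSemigroupParam A R B) :
    IsPauliPartition (cyclicClasses (semigroupStabilizer A R B)) := by
  obtain ⟨U, hU, hUC⟩ := h.implementable
  have hs : ∀ j : ℕ, ∀ a b, sympl (semigroupStabilizer A R B ^ j *ᵥ a)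
      (semigroupStabilizer A R B ^ j *ᵥ b) = sympl a b := fun j =>
    (hUC.pow j).sympl_mulVec (pow_mem hU j)
  have hinj : ∀ j : ℕ, Function.Injective (semigroupStabilizer A R B ^ j *ᵥ ·) := fun j =>
    mulVec_injective_of_sympl (hs j)
  have hz : Function.Injective (zVec : (Fin m → ZMod 2) → PVec m) := fun c c' hc => by
    funext i; exact congrFun hc (Sum.inl i)
  have hz0 : zVec (0 : Fin m → ZMod 2) = 0 := by
    funext i; rcases i with i | i <;> rfl
  have hunique : ∀ j k : Fin (2 ^ m + 1), ∀ c c' : Fin m → ZMod 2, c ≠ 0 → c' ≠ 0 →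
      semigroupStabilizer A R B ^ (j : ℕ) *ᵥ zVec c =
        semigroupStabilizer A R B ^ (k : ℕ) *ᵥ zVec c' → j = k ∧ c = c' := by
    intro j k c c' hc hc' he
    rcases le_total (j : ℕ) k with hjk | hjk
    · have := h.eq_of_pow_mulVec_eq hjk (by omega) hc' he
      exact ⟨Fin.ext this.1, this.2⟩
    · have := h.eq_of_pow_mulVec_eq hjk (by omega) hc he.symm
      exact ⟨Fin.ext this.1.symm, this.2.symm⟩
  have hne : ∀ j : ℕ, ∀ c : Fin m → ZMod 2, c ≠ 0 →
      semigroupStabilizer A R B ^ j *ᵥ zVec c ≠ 0 := by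
    intro j c hc h0
    apply hc
    apply hz
    apply hinj j
    simp only
    rw [h0, hz0, Matrix.mulVec_zero]
  refine ⟨fun j => mem_cyclicClasses.2 ⟨0, by rw [hz0, Matrix.mulVec_zero]⟩, fun j => ?_, ?_, ?_⟩
  · have : cyclicClasses (semigroupStabilizer A R B) j =
        Set.range fun c => semigroupStabilizer A R B ^ (j : ℕ) *ᵥ zVec c := by
      ext a; exact mem_cyclicClasses
    rw [this, ← Set.image_univ, Set.ncard_image_of_injective, Set.ncard_univ]
    · simp
    · exact (hinj j).comp hz
  · intro a ha
    -- Injectivity is enough: both sides have `(2 ^ m + 1) * (2 ^ m - 1) = 4 ^ m - 1` elements.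
    let F : Fin (2 ^ m + 1) × {c : Fin m → ZMod 2 // c ≠ 0} → {a : PVec m // a ≠ 0} := fun x =>
      ⟨semigroupStabilizer A R B ^ (x.1 : ℕ) *ᵥ zVec x.2.1, hne _ _ x.2.2⟩
    have hF : Function.Bijective F := by
      rw [Fintype.bijective_iff_injective_and_card]
      constructor
      · rintro ⟨j, c, hc⟩ ⟨k, c', hc'⟩ he
        obtain ⟨rfl, rfl⟩ := hunique j k c c' hc hc' (congrArg Subtype.val he)
        rfl
      · rw [Fintype.card_prod, Fintype.card_fin, Fintype.card_subtype_compl, Fintype.card_subtype_eq,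
          Fintype.card_subtype_compl, Fintype.card_subtype_eq, Fintype.card_fun, Fintype.card_fun,
          Fintype.card_sum, ZMod.card, Fintype.card_fin, pow_add, Nat.mul_sub, mul_one, add_mul,
          one_mul]
        omega
    obtain ⟨⟨j, c, hc⟩, hjc⟩ := hF.2 ⟨a, ha⟩
    have hjc : semigroupStabilizer A R B ^ (j : ℕ) *ᵥ zVec c = a := congrArg Subtype.val hjc
    refine ⟨j, mem_cyclicClasses.2 ⟨c, hjc⟩, fun k hk => ?_⟩
    obtain ⟨c', hc'⟩ := mem_cyclicClasses.1 hk
    have hc0 : c' ≠ 0 := by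
      rintro rfl
      rw [hz0, Matrix.mulVec_zero] at hc'
      exact ha hc'.symm
    exact (hunique k j c' c hc0 hc (hc'.trans hjc.symm)).1
  · intro j a ha b hb
    obtain ⟨c, rfl⟩ := mem_cyclicClasses.1 ha
    obtain ⟨c', rfl⟩ := mem_cyclicClasses.1 hb
    rw [pauli_commute_iff, hs]
    simp [sympl, zPart, xPart, dotProduct]

/-- The power fixes every vector of `Z` type and commutes with each `C ^ j`, so it fixes every class
pointwise; the classes cover the space. -/
lemma IsSemigroupParam.pow_eq_one (h : IsSemigroupParam A R B) :
    semigroupStabilizer A R B ^ (2 ^ m + 1) = 1 := by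
  refine Matrix.ext_of_mulVec_single fun i => ?_
  generalize (Pi.single i 1 : PVec m) = a
  obtain ⟨j, hj⟩ := h.isPauliPartition.exists_mem a
  obtain ⟨c, rfl⟩ := mem_cyclicClasses.1 hj
  rw [Matrix.one_mulVec, Matrix.mulVec_mulVec, ← pow_add, add_comm, pow_add,
    ← Matrix.mulVec_mulVec, h.pow_mulVec_zVec]

/-- A fixed vector of class `j` also lies in the next class, which for the last `j` is class `0`. -/
lemma IsSemigroupParam.eq_zero_of_fixed (hm : 0 < m) (h : IsSemigroupParam A R B) {a : PVec m}
    (ha : semigroupStabilizer A R B *ᵥ a = a) : a = 0 := by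
  by_contra ha0
  obtain ⟨j, hj, huniq⟩ := h.isPauliPartition.existsUnique a ha0
  obtain ⟨c, hc⟩ := mem_cyclicClasses.1 hj
  have h1 : semigroupStabilizer A R B ^ ((j : ℕ) + 1) *ᵥ zVec c = a := by
    rw [pow_succ', ← Matrix.mulVec_mulVec, hc, ha]
  have h2 : 1 < 2 ^ m := Nat.one_lt_two_pow hm.ne'
  by_cases hjm : (j : ℕ) + 1 < 2 ^ m + 1
  · have := huniq ⟨(j : ℕ) + 1, hjm⟩ (mem_cyclicClasses.2 ⟨c, h1⟩)
    have := congrArg Fin.val this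
    simp at this
  · have hj' : (j : ℕ) + 1 = 2 ^ m + 1 := by omega
    rw [hj', h.pow_eq_one, Matrix.one_mulVec] at h1
    have := huniq 0 (mem_cyclicClasses.2 ⟨c, by simpa using h1⟩)
    have := congrArg Fin.val this
    simp only [Fin.val_zero] at this
    omega

end Semigroup

end CyclicMUB

/-! ### Cyclic unitaries, and classes as orbits of a field -/

namespace CyclicMUB

variable {m : ℕ}

open Polynomial

/-! ### The cyclic unitary matrix -/

section Cyclic

variable {A R B : Matrix (Fin m) (Fin m) (ZMod 2)}

lemma smul_mem_unitaryGroup {U : QMat m} (hU : U ∈ Matrix.unitaryGroup (Fin m → ZMod 2) ℂ) {μ : ℂ}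
    (hμ : ‖μ‖ = 1) : μ • U ∈ Matrix.unitaryGroup (Fin m → ZMod 2) ℂ := by
  rw [Matrix.mem_unitaryGroup_iff, Matrix.star_eq_conjTranspose, Matrix.conjTranspose_smul,
    smul_mul_smul_comm, mul_conjTranspose_of_mem hU, Complex.star_def, Complex.mul_conj,
    Complex.normSq_eq_norm_sq, hμ]
  simp

lemma norm_eq_one_of_smul_one_mem {μ : ℂ}
    (h : (μ • 1 : QMat m) ∈ Matrix.unitaryGroup (Fin m → ZMod 2) ℂ) : ‖μ‖ = 1 := by
  have h1 := mul_conjTranspose_of_mem h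
  rw [Matrix.conjTranspose_smul, Matrix.conjTranspose_one, smul_mul_smul_comm, one_mul,
    Complex.star_def, Complex.mul_conj, Complex.normSq_eq_norm_sq] at h1
  have h2 := congrFun (congrFun h1 0) 0
  rw [Matrix.smul_apply, Matrix.one_apply_eq, smul_eq_mul, mul_one] at h2
  exact (pow_eq_one_iff_of_nonneg (norm_nonneg _) two_ne_zero).1 (by exact_mod_cast h2)

/-- If `U` implements `C`, then `U ^ (d + 1)` implements the identity and is a multiple of some
`weyl b`. It commutes with `U`, so `C b = b` and `b = 0`. A root of the inverse of the remaining
scalar normalizes `U`. -/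
lemma IsSemigroupParam.exists_unitary (hm : 0 < m) (h : IsSemigroupParam A R B) :
    ∃ U ∈ Matrix.unitaryGroup (Fin m → ZMod 2) ℂ, U ^ (2 ^ m + 1) = 1 ∧
      Implements U (semigroupStabilizer A R B) := by
  obtain ⟨U, hU, hUC⟩ := h.implementable
  have hUn := pow_mem hU (2 ^ m + 1)
  have h1 := hUC.pow (2 ^ m + 1)
  rw [h.pow_eq_one] at h1
  obtain ⟨b, c, hc, hb⟩ : ∃ b, ∃ c : ℂ, c ≠ 0 ∧ U ^ (2 ^ m + 1) = c • weyl b := by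
    refine exists_eq_smul_weyl (S := Set.univ) ?_
      (fun a ha => eq_zero_of_sympl_eq_zero fun b => ha b (Set.mem_univ b)) fun a _ => ?_
    · intro h0
      have := mul_conjTranspose_of_mem hUn
      rw [h0, zero_mul] at this
      exact zero_ne_one this
    · obtain ⟨c, -, hc⟩ := h1.conj_weyl hUn a
      refine ⟨c, ?_⟩
      rw [Matrix.one_mulVec] at hc
      rw [← smul_mul_assoc, ← hc, mul_assoc, conjTranspose_mul_of_mem hUn, mul_one]
  have hb0 : b = 0 := by
    refine h.eq_zero_of_fixed hm ?_
    obtain ⟨d, hd, hdb⟩ := hUC.conj_weyl hU b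
    have h2 : U * U ^ (2 ^ m + 1) * Uᴴ = U ^ (2 ^ m + 1) := by
      rw [← pow_succ', pow_succ, mul_assoc, mul_conjTranspose_of_mem hU, mul_one]
    rw [hb, mul_smul_comm, smul_mul_assoc] at h2
    have h3 := smul_right_injective _ hc h2
    rw [hdb] at h3
    exact eq_of_smul_weyl_eq h3
  rw [hb0, weyl_zero] at hb
  have hcn : ‖c‖ = 1 := norm_eq_one_of_smul_one_mem (hb ▸ hUn)
  obtain ⟨μ, hμ⟩ := IsAlgClosed.exists_pow_nat_eq c⁻¹ (Nat.succ_pos (2 ^ m))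
  have hμn : ‖μ‖ = 1 := by
    have h4 : ‖μ‖ ^ (2 ^ m + 1) = 1 := by rw [← norm_pow, hμ, norm_inv, hcn, inv_one]
    exact (pow_eq_one_iff_of_nonneg (norm_nonneg _) (Nat.succ_ne_zero _)).1 h4
  refine ⟨μ • U, smul_mem_unitaryGroup hU hμn, ?_, hUC.smul μ⟩
  rw [_root_.smul_pow, hμ, hb, inv_smul_smul₀ hc]

lemma isEigenbasisFamily_pow {C : SMat m} {U : QMat m}
    (hU : U ∈ Matrix.unitaryGroup (Fin m → ZMod 2) ℂ) (hUC : Implements U C) :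
    IsEigenbasisFamily (cyclicClasses C) (fun j => U ^ (j : ℕ)) := by
  rw [isEigenbasisFamily_iff]
  intro j
  have h1 := (hUC.pow j).isEigenbasis (pow_mem hU j) isEigenbasis_one
  rw [mul_one, ← Set.range_comp] at h1
  simpa only [cyclicClasses, Function.comp_def, Matrix.mulVec_mulVec] using h1

lemma isCyclicMUB_pow {U : QMat m} (hU : U ∈ Matrix.unitaryGroup (Fin m → ZMod 2) ℂ)
    (hU1 : U ^ (2 ^ m + 1) = 1) (h : IsCompleteMUB fun j : Fin (2 ^ m + 1) => U ^ (j : ℕ)) :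
    IsCyclicMUB fun j : Fin (2 ^ m + 1) => U ^ (j : ℕ) := by
  -- The family starts with `U ^ 0`, whereas the definition of cyclicity counts from `U ^ 1` to `U ^
  -- (d + 1)`; the rotation shifts the index by one.
  refine ⟨h, U, hU, hU1, finRotate _, fun j => ⟨Equiv.refl _, ?_⟩⟩
  have : U ^ ((finRotate (2 ^ m + 1) j : Fin (2 ^ m + 1)) : ℕ) = U ^ ((j : ℕ) + 1) := by
    rcases eq_or_ne j (Fin.last _) with rfl | hj
    · rw [finRotate_last, Fin.val_zero, pow_zero, Fin.val_last, hU1]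
    · rw [coe_finRotate_of_ne_last hj]
  simp only [this]
  rfl

end Cyclic

/-! ### Equality of class sets -/

section Field

variable {A R B : Matrix (Fin m) (Fin m) (ZMod 2)}

/-- The action of polynomials in `B` that preserves the classes. -/
noncomputable def classAction (A B : Matrix (Fin m) (Fin m) (ZMod 2)) (f : (ZMod 2)[X]) : SMat m :=
  Matrix.fromBlocks (aeval B f) (aeval B f * A + A * (aeval B f)ᵀ) 0 (aeval B f)ᵀ

lemma classAction_comp (f g : (ZMod 2)[X]) :
    classAction A (aeval B g) f = classAction A B (f.comp g) := by
  simp only [classAction, aeval_comp]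

/-- Symmetry of `BR` says `R Bᵀ = B R`, a relation that passes to polynomials in `B`. -/
lemma IsSemigroupParam.transpose_aeval_mul_inv (h : IsSemigroupParam A R B) (f : (ZMod 2)[X]) :
    (aeval B f)ᵀ * R⁻¹ = R⁻¹ * aeval B f := by
  have h1 : SemiconjBy R Bᵀ B := by
    have := h.isSymm_BR.eq
    rwa [Matrix.transpose_mul, h.isSymm_R.eq] at this
  have h2 := (semiconjBy_aeval h1 f).eq
  rw [← transpose_aeval] at h2
  calc (aeval B f)ᵀ * R⁻¹ = R⁻¹ * (R * (aeval B f)ᵀ) * R⁻¹ := by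
        rw [← mul_assoc, h.inv_mul, one_mul]
    _ = R⁻¹ * aeval B f := by rw [h2, mul_assoc, mul_assoc, h.mul_inv, mul_one]

lemma IsSemigroupParam.classAction_mulVec (h : IsSemigroupParam A R B) (f : (ZMod 2)[X]) (n : ℕ)
    (c : Fin m → ZMod 2) :
    classAction A B f *ᵥ (semigroupStabilizer A R B ^ n *ᵥ zVec c) =
      semigroupStabilizer A R B ^ n *ᵥ zVec (aeval B f *ᵥ c) := by
  rw [semigroupStabilizer_pow_mulVec h, semigroupStabilizer_pow_mulVec h, classAction,
    Matrix.fromBlocks_mulVec]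
  have h1 : ∀ k, aeval B f * fibMat B k = fibMat B k * aeval B f := fun k => by
    rw [fibMat, ← map_mul, ← map_mul, mul_comm]
  have h2 := h.transpose_aeval_mul_inv f
  simp only [Sum.elim_comp_inl, Sum.elim_comp_inr, Matrix.mulVec_add, Matrix.mulVec_mulVec,
    add_mul, Matrix.add_mulVec, mul_assoc]
  simp only [← mul_assoc, h2]
  congr 1
  · rw [mul_assoc (A * R⁻¹) (aeval B f), h1, h1, mul_assoc (A * R⁻¹) (fibMat B n)]
    linear_combination pi_add_self ((aeval B f * A * R⁻¹ * fibMat B n) *ᵥ c)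
  · rw [mul_assoc R⁻¹, h1, ← mul_assoc]
    simp

/-- Transitivity of `F_2[B]` on nonzero vectors makes the class through `v` the orbit of `v`. The
right-hand side involves neither `j` nor `R`, which allows different sets of classes to be compared.
-/
lemma IsSemigroupParam.mem_cyclicClasses_iff (h : IsSemigroupParam A R B) {j : Fin (2 ^ m + 1)}
    {v : PVec m} (hv : v ∈ cyclicClasses (semigroupStabilizer A R B) j) (hv0 : v ≠ 0) {w : PVec m} :
    w ∈ cyclicClasses (semigroupStabilizer A R B) j ↔ ∃ f, classAction A B f *ᵥ v = w := by
  obtain ⟨c, rfl⟩ := mem_cyclicClasses.1 hv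
  have hc : c ≠ 0 := by
    rintro rfl
    apply hv0
    have : zVec (0 : Fin m → ZMod 2) = 0 := by
      funext i; rcases i with i | i <;> rfl
    rw [this, Matrix.mulVec_zero]
  have hs := polyMulVec_surjective h.index.1 (Matrix.aeval_self_charpoly B)
    (Matrix.charpoly_natDegree_eq_dim B) hc
  simp only [h.classAction_mulVec]
  rw [mem_cyclicClasses]
  constructor
  · rintro ⟨c', rfl⟩
    obtain ⟨f, rfl⟩ := hs c'
    exact ⟨f, rfl⟩
  · rintro ⟨f, rfl⟩
    exact ⟨_, rfl⟩

/-- The set of classes depends only on `A` and on the algebra generated by `B`. -/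
lemma IsSemigroupParam.exists_perm (hm : 0 < m) (h : IsSemigroupParam A R B)
    {R' : Matrix (Fin m) (Fin m) (ZMod 2)} {g : (ZMod 2)[X]}
    (h' : IsSemigroupParam A R' (aeval B g)) : ∃ π : Equiv.Perm (Fin (2 ^ m + 1)), ∀ j,
      cyclicClasses (semigroupStabilizer A R B) j =
        cyclicClasses (semigroupStabilizer A R' (aeval B g)) (π j) := by
  refine h.isPauliPartition.exists_perm hm h'.isPauliPartition fun i j v hv hi hj => ?_
  refine ((h'.isPauliPartition.isLagrangian j).eq_of_subset (h.isPauliPartition.isLagrangian i)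
    fun w hw => ?_).symm
  obtain ⟨f, rfl⟩ := (h'.mem_cyclicClasses_iff hj hv).1 hw
  rw [classAction_comp]
  exact (h.mem_cyclicClasses_iff hi hv).2 ⟨_, rfl⟩

lemma semigroupStabilizer_zero_one (B : Matrix (Fin m) (Fin m) (ZMod 2)) :
    semigroupStabilizer 0 1 B = fieldStabilizer B := by
  simp [semigroupStabilizer, fieldStabilizer]

lemma IsFieldParam.isSemigroupParam (h : IsFieldParam B) : IsSemigroupParam 0 1 B :=
  ⟨isUnit_one, h.isUnit, Matrix.isSymm_zero, Matrix.isSymm_one, by rw [mul_one]; exact h.isSymm,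
    h.index⟩

/-- Upper triangular symplectic matrices map field-based sets to semigroup-based sets. -/
lemma IsFieldParam.conj {B₀ N W : Matrix (Fin m) (Fin m) (ZMod 2)} (h : IsFieldParam B₀)
    (hA : A.IsSymm) (hNW : Nᵀ * W = 1) (hB : N * B₀ = B * N) : IsSemigroupParam A (N * Nᵀ) B ∧
      ∀ j, cyclicClasses (semigroupStabilizer A (N * Nᵀ) B) j =
        (Matrix.fromBlocks N (A * W) 0 W *ᵥ ·) '' cyclicClasses (fieldStabilizer B₀) j := by
  have hWN : W * Nᵀ = 1 := mul_eq_one_comm.1 hNW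
  have hNWt : N * Wᵀ = 1 := by
    rw [← Matrix.transpose_transpose N, ← Matrix.transpose_mul, hWN, Matrix.transpose_one]
  have hWtN : Wᵀ * N = 1 := mul_eq_one_comm.1 hNWt
  have hN : IsUnit N := ⟨⟨N, Wᵀ, hNWt, hWtN⟩, rfl⟩
  have hB' : B = N * B₀ * Wᵀ := by rw [hB, mul_assoc, hNWt, mul_one]
  have hp : IsSemigroupParam A (N * Nᵀ) B := by
    refine ⟨hN.mul ⟨⟨Nᵀ, W, hNW, hWN⟩, rfl⟩, ?_, hA, ?_, ?_, ?_⟩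
    · rw [hB']
      exact (hN.mul h.isUnit).mul ⟨⟨Wᵀ, N, hWtN, hNWt⟩, rfl⟩
    · rw [Matrix.IsSymm, Matrix.transpose_mul, Matrix.transpose_transpose]
    · rw [← mul_assoc, ← hB, Matrix.IsSymm, Matrix.transpose_mul, Matrix.transpose_mul,
        Matrix.transpose_transpose, h.isSymm.eq, mul_assoc]
    · have : B.charpoly = B₀.charpoly := by
        rw [hB']
        obtain ⟨u, hu, hu'⟩ : ∃ u : (Matrix (Fin m) (Fin m) (ZMod 2))ˣ, u.val = N ∧ u⁻¹.val = Wᵀ :=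
          ⟨⟨N, Wᵀ, hNWt, hWtN⟩, rfl, rfl⟩
        rw [← hu, ← hu', Matrix.coe_units_inv, Matrix.charpoly_units_conj]
      rw [this]
      exact h.index
  have hW : (N * Nᵀ)⁻¹ * N = W := by
    calc (N * Nᵀ)⁻¹ * N = (N * Nᵀ)⁻¹ * (N * (Nᵀ * W)) := by rw [hNW, mul_one]
      _ = W := by rw [← mul_assoc N, ← mul_assoc, hp.inv_mul, one_mul]
  refine ⟨hp, fun j => ?_⟩
  -- `N` intertwines `F_k(B₀)` with `F_k(B)`, and `(N Nᵀ)⁻¹ N = W` matches the `X` parts; hence the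
  -- `j`-th generators correspond.
  have key : ∀ c, Matrix.fromBlocks N (A * W) 0 W *ᵥ (fieldStabilizer B₀ ^ (j : ℕ) *ᵥ zVec c) =
      semigroupStabilizer A (N * Nᵀ) B ^ (j : ℕ) *ᵥ zVec (N *ᵥ c) := by
    intro c
    rw [← semigroupStabilizer_zero_one, semigroupStabilizer_pow_mulVec h.isSemigroupParam,
      semigroupStabilizer_pow_mulVec hp, Matrix.fromBlocks_mulVec]
    have h1 : ∀ k, N * fibMat B₀ k = fibMat B k * N := fun k => semiconjBy_aeval hB _
    simp only [Sum.elim_comp_inl, Sum.elim_comp_inr, Matrix.mulVec_mulVec, zero_mul,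
      Matrix.zero_mulVec, add_zero, inv_one, one_mul, zero_add, h1]
    simp only [mul_assoc A, ← h1, ← mul_assoc _ N, hW]
  ext a
  rw [mem_cyclicClasses]
  constructor
  · rintro ⟨c, rfl⟩
    refine ⟨_, mem_cyclicClasses.2 ⟨Wᵀ *ᵥ c, rfl⟩, ?_⟩
    simp only
    rw [key, Matrix.mulVec_mulVec, hNWt, Matrix.one_mulVec]
  · rintro ⟨_, hb, rfl⟩
    obtain ⟨c, rfl⟩ := mem_cyclicClasses.1 hb
    exact ⟨_, (key c).symm⟩

/-- Every semigroup-based set of classes is the image of every field-based one. -/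
lemma IsSemigroupParam.exists_implementable (hm : 0 < m) (h : IsSemigroupParam A R B)
    {B₀ : Matrix (Fin m) (Fin m) (ZMod 2)} (h₀ : IsFieldParam B₀) :
    ∃ M : SMat m, Implementable M ∧ ∃ π : Equiv.Perm (Fin (2 ^ m + 1)), ∀ j,
      cyclicClasses (semigroupStabilizer A R B) j =
        (M *ᵥ ·) '' cyclicClasses (fieldStabilizer B₀) (π j) := by
  -- The field `F_2[B]` contains a root `g(B)` of the characteristic polynomial of `B₀`; `B₀` is
  -- similar to it, and replacing `g(B)` by `B` only permutes the classes.
  obtain ⟨g, hg⟩ := exists_dvd_comp h₀.index.1 h.index.1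
    (h₀.isSemigroupParam.natDegree.trans h.natDegree.symm)
  have hg0 : aeval (aeval B g) B₀.charpoly = 0 := by
    obtain ⟨q, hq⟩ := hg
    rw [← aeval_comp, hq, map_mul, Matrix.aeval_self_charpoly, zero_mul]
  have : Nonempty (Fin m) := ⟨⟨0, hm⟩⟩
  obtain ⟨N, hN, hNB⟩ := exists_similar h₀.index.1 (Matrix.charpoly_natDegree_eq_dim B₀)
    (Matrix.aeval_self_charpoly B₀) hg0
  have hNW : Nᵀ * (Nᵀ)⁻¹ = 1 := by
    refine Matrix.mul_nonsing_inv _ ?_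
    rw [Matrix.det_transpose]
    exact (Matrix.isUnit_iff_isUnit_det _).1 hN
  obtain ⟨hp, hcl⟩ := h₀.conj h.isSymm_A hNW hNB
  obtain ⟨π, hπ⟩ := h.exists_perm hm hp
  refine ⟨Matrix.fromBlocks N (A * (Nᵀ)⁻¹) 0 (Nᵀ)⁻¹, ?_, π, fun j => by rw [hπ j, hcl]⟩
  have : Matrix.fromBlocks N (A * (Nᵀ)⁻¹) 0 (Nᵀ)⁻¹ =
      Matrix.fromBlocks 1 A 0 1 * Matrix.fromBlocks N 0 0 (Nᵀ)⁻¹ := by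
    simp [Matrix.fromBlocks_multiply]
  rw [this]
  exact (implementable_shear h.isSymm_A).mul (implementable_diag hNW)

lemma mubEquivalent_of_image {K L : Fin (2 ^ m + 1) → Set (PVec m)} (hL : ∀ j, IsLagrangian (L j))
    {M : SMat m} (hM : Implementable M) {π : Equiv.Perm (Fin (2 ^ m + 1))}
    (h : ∀ j, L j = (M *ᵥ ·) '' K (π j)) {𝓑₀ 𝓑 : Fin (2 ^ m + 1) → QMat m}
    (h₀ : IsEigenbasisFamily K 𝓑₀) (h𝓑 : IsEigenbasisFamily L 𝓑) : MUBEquivalent 𝓑₀ 𝓑 := by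
  rw [isEigenbasisFamily_iff] at h₀ h𝓑
  obtain ⟨U, hU, hUM⟩ := hM
  have h1 : ∀ j, IsEigenbasis (L j) (U * 𝓑₀ (π j)) := fun j => by
    rw [h j]
    exact hUM.isEigenbasis hU (h₀ _)
  choose W hW hWj using fun j => (h1 j).exists_monomial (hL j) (h𝓑 j)
  exact ⟨U, hU, π, W, hW, hWj⟩

end Field

end CyclicMUB

/-! ### Existence of symmetric matrices with the required Fibonacci index -/

namespace CyclicMUB

variable {m : ℕ}

open Polynomial

/-! ### Orthonormal bases of symmetric bilinear forms over the field with two elements -/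

section Orthonormal

variable {V : Type*} [AddCommGroup V] [Module (ZMod 2) V]

/-- Since `β v v = 1`, the space splits into the line of `v` and its orthogonal complement, so the
form stays nondegenerate on the complement. -/
lemma nondegenerate_ker {β : LinearMap.BilinForm (ZMod 2) V} (hsymm : ∀ x y, β x y = β y x)
    (hnd : ∀ x, (∀ y, β x y = 0) → x = 0) {v : V} (hv : β v v = 1) {x : V} (hx : β v x = 0)
    (h : ∀ y, β v y = 0 → β x y = 0) : x = 0 := by
  refine hnd x fun y => ?_
  have h1 := h (y - β v y • v) (by rw [map_sub, map_smul, hv, smul_eq_mul, mul_one, sub_self])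
  rwa [map_sub, map_smul, hsymm x v, hx, smul_zero, sub_zero] at h1

variable [FiniteDimensional (ZMod 2) V]

lemma finrank_ker_of_self_eq_one {β : LinearMap.BilinForm (ZMod 2) V} {v : V} (hv : β v v = 1) :
    Module.finrank (ZMod 2) (LinearMap.ker (β v)) + 1 = Module.finrank (ZMod 2) V := by
  have hs : Function.Surjective (β v) := fun c => ⟨c • v, by rw [map_smul, hv, smul_eq_mul, mul_one]⟩
  rw [← LinearMap.finrank_range_add_finrank_ker (β v), LinearMap.range_eq_top.2 hs, finrank_top,
    Module.finrank_self, add_comm]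

/-- The first vector can be chosen such that the form on its orthogonal complement is not
alternating. -/
lemma exists_self_eq_one {β : LinearMap.BilinForm (ZMod 2) V} (hsymm : ∀ x y, β x y = β y x)
    (hnd : ∀ x, (∀ y, β x y = 0) → x = 0) (hna : ∃ x, β x x = 1) :
    ∃ v, β v v = 1 ∧ (Module.finrank (ZMod 2) (LinearMap.ker (β v)) ≠ 0 →
      ∃ w, β v w = 0 ∧ β w w = 1) := by
  obtain ⟨v, hv⟩ := hna
  by_cases hw : ∃ w, β v w = 0 ∧ β w w = 1
  · exact ⟨v, hv, fun _ => hw⟩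
  push Not at hw
  have hw0 : ∀ w, β v w = 0 → β w w = 0 := fun w h => (zmod_two_cases _).resolve_right (hw w h)
  by_cases h0 : Module.finrank (ZMod 2) (LinearMap.ker (β v)) = 0
  · exact ⟨v, hv, fun h => absurd h0 h⟩
  obtain ⟨⟨x, hx⟩, hx0⟩ := Module.finrank_pos_iff_exists_ne_zero.1 (Nat.pos_of_ne_zero h0)
  rw [LinearMap.mem_ker] at hx
  have hx0 : x ≠ 0 := fun h => hx0 (Subtype.ext h)
  obtain ⟨y, hy, hxy⟩ : ∃ y, β v y = 0 ∧ β x y = 1 := by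
    by_contra! hcon
    exact hx0 (nondegenerate_ker hsymm hnd hv hx fun y hy =>
      (zmod_two_cases _).resolve_right (hcon y hy))
  have hxv : β x v = 0 := (hsymm x v).trans hx
  have hyv : β y v = 0 := (hsymm y v).trans hy
  have h2 : (1 + 1 : ZMod 2) = 0 := by decide
  -- The form is alternating on the complement of `v`, with `x`, `y` there and `β x y = 1`. Then `β
  -- (v+x) (v+x) = 1`, `β (v+x) (y+v) = 1 + 1 = 0` and `β (y+v) (y+v) = 1`.
  refine ⟨v + x, ?_, fun _ => ⟨y + v, ?_, ?_⟩⟩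
  · simp [hv, hx, hxv, hw0 x hx]
  · simp [hv, hy, hxy, hxv, h2]
  · simp [hv, hy, hyv, hw0 y hy]

/-- Nondegenerate symmetric bilinear forms over the field with two elements that are not
alternating have orthonormal bases. -/
lemma exists_orthonormal_family (d : ℕ) {V : Type*} [AddCommGroup V] [Module (ZMod 2) V]
    [FiniteDimensional (ZMod 2) V] (hd : Module.finrank (ZMod 2) V = d)
    {β : LinearMap.BilinForm (ZMod 2) V} (hsymm : ∀ x y, β x y = β y x)
    (hnd : ∀ x, (∀ y, β x y = 0) → x = 0) (hna : d ≠ 0 → ∃ x, β x x = 1) :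
    ∃ v : Fin d → V, ∀ i j, β (v i) (v j) = if i = j then 1 else 0 := by
  induction d generalizing V with
  | zero => exact ⟨Fin.elim0, fun i => i.elim0⟩
  | succ d ih =>
    obtain ⟨v, hv, hw⟩ := exists_self_eq_one hsymm hnd (hna (Nat.succ_ne_zero d))
    have hfr := finrank_ker_of_self_eq_one hv
    rw [hd, add_left_inj] at hfr
    rw [hfr] at hw
    obtain ⟨v', hv'⟩ := ih hfr (β := β.domRestrict₁₂ (LinearMap.ker (β v)) (LinearMap.ker (β v)))
      (fun x y => hsymm x y)
      (fun x hx => Subtype.ext (nondegenerate_ker hsymm hnd hv x.2 fun y hy => hx ⟨y, hy⟩))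
      (fun h0 => by
        obtain ⟨w, hw0, hw1⟩ := hw h0
        exact ⟨⟨w, hw0⟩, hw1⟩)
    refine ⟨Fin.cons v fun i => (v' i : V), fun i j => ?_⟩
    refine Fin.cases ?_ (fun i => ?_) i <;> refine Fin.cases ?_ (fun j => ?_) j
    · simp [hv]
    · rw [Fin.cons_zero, Fin.cons_succ, if_neg (Fin.succ_ne_zero j).symm]
      exact (v' j).2
    · rw [Fin.cons_zero, Fin.cons_succ, if_neg (Fin.succ_ne_zero i), hsymm]
      exact (v' i).2
    · rw [Fin.cons_succ, Fin.cons_succ]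
      exact (hv' i j).trans (if_congr Fin.succ_inj.symm rfl rfl)

lemma exists_orthonormal_basis {β : LinearMap.BilinForm (ZMod 2) V}
    (hsymm : ∀ x y, β x y = β y x) (hnd : ∀ x, (∀ y, β x y = 0) → x = 0)
    (hna : ∃ x, β x x = 1) {d : ℕ} (hd : Module.finrank (ZMod 2) V = d) :
    ∃ b : Module.Basis (Fin d) (ZMod 2) V, ∀ x i, b.repr x i = β (b i) x := by
  obtain ⟨v, hv⟩ := exists_orthonormal_family d hd hsymm hnd fun _ => hna
  have hcoeff : ∀ (g : Fin d → ZMod 2) i, β (v i) (∑ j, g j • v j) = g i := by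
    intro g i
    simp [map_sum, hv]
  have hli : LinearIndependent (ZMod 2) v := by
    refine Fintype.linearIndependent_iff.2 fun g hg i => ?_
    rw [← hcoeff g i, hg, map_zero]
  have hne : Nonempty (Fin d) := by
    obtain ⟨x, hx⟩ := hna
    have : x ≠ 0 := by
      rintro rfl
      simp at hx
    have := Module.finrank_pos_iff_exists_ne_zero (R := ZMod 2).2 ⟨x, this⟩
    exact ⟨⟨0, hd ▸ this⟩⟩
  refine ⟨basisOfLinearIndependentOfCardEqFinrank hli (by rw [Fintype.card_fin, hd]),
    fun x i => ?_⟩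
  set b := basisOfLinearIndependentOfCardEqFinrank hli (by rw [Fintype.card_fin, hd]) with hb
  conv_rhs => rw [← b.sum_repr x]
  rw [hb, coe_basisOfLinearIndependentOfCardEqFinrank, hcoeff]

end Orthonormal

/-! ### Existence of admissible parameters -/

/-- In characteristic two `z ^ n + z⁻¹ ^ n` obeys the Fibonacci recursion at `z + z⁻¹`. Zeros of
`F_n` are thereby governed by the order of `z`. -/
lemma aeval_fibPoly_mul {E : Type*} [Field E] [Algebra (ZMod 2) E] {z : E} (hz : z ≠ 0) (n : ℕ) :
    aeval (z + z⁻¹) (fibPoly (ZMod 2) n) * (z + z⁻¹) = z ^ n + z⁻¹ ^ n := by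
  have hchar : CharP E 2 := charP_of_injective_algebraMap' (ZMod 2) 2
  have h2 : (2 : E) = 0 := CharTwo.two_eq_zero
  have hzz : z * z⁻¹ = 1 := mul_inv_cancel₀ hz
  induction n using Nat.twoStepInduction with
  | zero => simp only [fibPoly, map_zero, zero_mul, pow_zero]; linear_combination -h2
  | one => simp [fibPoly]
  | more n h0 h1 =>
    rw [fibPoly_add_two, map_add, map_mul, aeval_X, add_mul, mul_assoc, h1, h0]
    linear_combination (z ^ n + z⁻¹ ^ n) * (hzz + h2)

/-- There is an element whose minimal polynomial has the required Fibonacci index. -/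
lemma exists_fibonacci_element (hm : 0 < m) {E : Type*} [Field E] [Finite E]
    [Algebra (ZMod 2) E] (hE : Nat.card E = 2 ^ (2 * m)) : ∃ x : E, x ≠ 0 ∧
    (minpoly (ZMod 2) x).natDegree = m ∧ HasFibonacciIndex (minpoly (ZMod 2) x) (2 ^ m + 1) := by
  have hchar : CharP E 2 := charP_of_injective_algebraMap' (ZMod 2) 2
  have h2 : (2 : E) = 0 := CharTwo.two_eq_zero
  have hpow : 2 ≤ 2 ^ m := Nat.le_self_pow hm.ne' 2
  -- A power of a generator of the multiplicative group gives `z` of order `2 ^ m + 1`; the required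
  -- element is `z + z⁻¹`.
  obtain ⟨g, hg⟩ := IsCyclic.exists_ofOrder_eq_natCard (α := Eˣ)
  have hcard : Nat.card Eˣ = (2 ^ m - 1) * (2 ^ m + 1) := by
    rw [Nat.card_units, hE, mul_comm 2 m, pow_mul,
      Nat.mul_comm (2 ^ m - 1), ← Nat.sq_sub_sq, one_pow]
  have hord : orderOf ((g ^ (2 ^ m - 1) : Eˣ) : E) = 2 ^ m + 1 := by
    rw [orderOf_units, orderOf_pow_of_dvd (by omega) (by rw [hg, hcard]; exact dvd_mul_right _ _),
      hg, hcard, Nat.mul_div_cancel_left _ (by omega)]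
  have hz : ((g ^ (2 ^ m - 1) : Eˣ) : E) ≠ 0 := Units.ne_zero _
  generalize ((g ^ (2 ^ m - 1) : Eˣ) : E) = z at hord hz
  have hzz : z * z⁻¹ = 1 := mul_inv_cancel₀ hz
  have hpz : ∀ n, z ^ n = 1 ↔ 2 ^ m + 1 ∣ n := fun n => by rw [← hord, orderOf_dvd_iff_pow_eq_one]
  have heven : Even (2 ^ m) := even_two.pow_of_ne_zero hm.ne'
  -- Vanishing means `z ^ (2 * n) = 1`; the factor two can be dropped because the order of `z` is
  -- odd.
  have hdvd : ∀ n, z ^ n + z⁻¹ ^ n = 0 ↔ 2 ^ m + 1 ∣ n := by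
    intro n
    have hn : z ^ n * z⁻¹ ^ n = 1 := by rw [← mul_pow, hzz, one_pow]
    have hcop : Nat.Coprime (2 ^ m + 1) 2 := (heven.add_one).coprime_two_right
    rw [← hcop.dvd_mul_left, ← hpz, two_mul, pow_add]
    constructor
    · intro h
      linear_combination z ^ n * h - hn - h2
    · intro h
      have h3 : z ^ n ≠ 0 := pow_ne_zero _ hz
      refine mul_left_cancel₀ h3 ?_
      linear_combination h + hn + h2
  have hx0 : z + z⁻¹ ≠ 0 := by
    intro h
    have := (hdvd 1).1 (by simpa using h)
    have := Nat.le_of_dvd one_pos this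
    omega
  have hint : IsIntegral (ZMod 2) (z + z⁻¹) := Algebra.IsIntegral.isIntegral _
  have hfrob : ∀ k, (z + z⁻¹) ^ 2 ^ k = z ^ 2 ^ k + z⁻¹ ^ 2 ^ k := fun k => add_pow_char_pow _ _ 2 k
  have hirr := minpoly.irreducible hint
  -- The `m`-th power of Frobenius inverts `z`, hence fixes `z + z⁻¹`.
  have hdeg1 : (minpoly (ZMod 2) (z + z⁻¹)).natDegree ∣ m := by
    refine hirr.natDegree_dvd_of_dvd_X_pow_card_pow_sub_X (minpoly.dvd _ _ ?_)
    have h3 : z ^ 2 ^ m * z = 1 := by rw [← pow_succ, hpz]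
    have h4 : z ^ 2 ^ m = z⁻¹ := eq_inv_of_mul_eq_one_left h3
    have h5 : z⁻¹ ^ 2 ^ m = z := by rw [inv_pow, h4, inv_inv]
    rw [Nat.card_zmod, map_sub, map_pow, aeval_X, hfrob, h4, h5]
    ring
  -- If the degree is `k`, the `k`-th power of Frobenius fixes `z + z⁻¹`, so it sends `z` to `z` or
  -- `z⁻¹`. Thus `2 ^ m + 1` divides `2 ^ k - 1` or `2 ^ k + 1`.
  have hdeg2 : m ≤ (minpoly (ZMod 2) (z + z⁻¹)).natDegree := by
    set k := (minpoly (ZMod 2) (z + z⁻¹)).natDegree with hk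
    have hkpos : 0 < k := minpoly.natDegree_pos hint
    have hpowk : 2 ≤ 2 ^ k := Nat.le_self_pow hkpos.ne' 2
    have hxk : (z + z⁻¹) ^ 2 ^ k = z + z⁻¹ := by
      have h3 : Nat.card (IntermediateField.adjoin (ZMod 2) {z + z⁻¹}) = 2 ^ k := by
        rw [Module.natCard_eq_pow_finrank (K := ZMod 2), Nat.card_zmod,
          IntermediateField.adjoin.finrank hint]
      have := Fintype.ofFinite (IntermediateField.adjoin (ZMod 2) {z + z⁻¹})
      have h4 := FiniteField.pow_card (IntermediateField.AdjoinSimple.gen (ZMod 2) (z + z⁻¹))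
      rw [← Nat.card_eq_fintype_card, h3] at h4
      simpa using congrArg (algebraMap _ E) h4
    rw [hfrob] at hxk
    have h5 : z ^ 2 ^ k * z⁻¹ ^ 2 ^ k = 1 := by rw [← mul_pow, hzz, one_pow]
    have h6 : (z ^ 2 ^ k - z) * (z ^ 2 ^ k * z - 1) = 0 := by
      linear_combination (z ^ 2 ^ k * z) * hxk - z * h5 + z ^ 2 ^ k * hzz
    have h7 : 2 ^ m + 1 ≤ 2 ^ k + 1 := by
      rcases mul_eq_zero.1 h6 with h | h
      · have : z ^ (2 ^ k - 1) = 1 := by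
          refine mul_right_cancel₀ hz ?_
          rw [← pow_succ, Nat.sub_add_cancel (by omega), one_mul]
          exact sub_eq_zero.1 h
        have := Nat.le_of_dvd (by omega) ((hpz _).1 this)
        omega
      · refine Nat.le_of_dvd (by omega) ((hpz _).1 ?_)
        rw [pow_succ]
        exact sub_eq_zero.1 h
    exact (Nat.pow_le_pow_iff_right (by norm_num)).1 (by omega : 2 ^ m ≤ 2 ^ k)
  have hfib : ∀ n, minpoly (ZMod 2) (z + z⁻¹) ∣ fibPoly (ZMod 2) n ↔ 2 ^ m + 1 ∣ n := by
    intro n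
    rw [← hdvd, ← aeval_fibPoly_mul hz, mul_eq_zero_iff_right hx0]
    exact (minpoly.dvd_iff).trans Iff.rfl
  refine ⟨z + z⁻¹, hx0, le_antisymm (Nat.le_of_dvd hm hdeg1) hdeg2, hirr, ?_, ?_⟩
  · exact ⟨Nat.succ_pos _, (hfib _).2 dvd_rfl⟩
  · rintro n ⟨hn, hdn⟩
    exact Nat.le_of_dvd hn ((hfib n).1 hdn)

/-- The multiplication by a field element has a symmetric matrix. -/
lemma exists_isSymm_charpoly {E : Type*} [Field E] [Finite E] [Algebra (ZMod 2) E] {x : E}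
    (hx0 : x ≠ 0) (hdeg : (minpoly (ZMod 2) x).natDegree = m) :
    ∃ B : Matrix (Fin m) (Fin m) (ZMod 2), IsUnit B ∧ B.IsSymm ∧
      B.charpoly = minpoly (ZMod 2) x := by
  have hint : IsIntegral (ZMod 2) x := Algebra.IsIntegral.isIntegral _
  set L := IntermediateField.adjoin (ZMod 2) {x}
  set y : L := IntermediateField.AdjoinSimple.gen (ZMod 2) x with hy
  have hfr : Module.finrank (ZMod 2) L = m := by rw [IntermediateField.adjoin.finrank hint, hdeg]
  -- The trace is surjective and every element is a square in characteristic two, so the trace form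
  -- is not alternating.
  have hna : ∃ a : L, Algebra.traceForm (ZMod 2) L a a = 1 := by
    obtain ⟨a, ha⟩ := Algebra.trace_surjective (ZMod 2) L 1
    have hchar : CharP L 2 := charP_of_injective_algebraMap' (ZMod 2) 2
    obtain ⟨b, rfl⟩ := FiniteField.isSquare_of_char_two (ringChar.eq L 2) a
    exact ⟨b, by rw [Algebra.traceForm_apply, ha]⟩
  obtain ⟨b, hb⟩ := exists_orthonormal_basis (β := Algebra.traceForm (ZMod 2) L)
    (fun u v => by rw [Algebra.traceForm_apply, Algebra.traceForm_apply, mul_comm])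
    (fun u hu => (traceForm_nondegenerate (ZMod 2) L).1 u hu) hna hfr
  have hchar : (Algebra.leftMulMatrix b y).charpoly = minpoly (ZMod 2) x := by
    rw [← IntermediateField.minpoly_gen (ZMod 2) x]
    refine (eq_of_monic_of_dvd_of_natDegree_le (minpoly.monic (Algebra.IsIntegral.isIntegral _))
      (Matrix.charpoly_monic _) (minpoly.dvd _ _ ?_) ?_)
    · apply Algebra.leftMulMatrix_injective b
      rw [map_zero, ← aeval_algHom_apply, Matrix.aeval_self_charpoly]
    · rw [Matrix.charpoly_natDegree_eq_dim, Fintype.card_fin, IntermediateField.minpoly_gen, hdeg]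
  have hy0 : y ≠ 0 := by
    intro h
    have := congrArg (algebraMap L E) h
    rw [hy, IntermediateField.AdjoinSimple.algebraMap_gen, map_zero] at this
    exact hx0 this
  refine ⟨Algebra.leftMulMatrix b y, (isUnit_iff_ne_zero.2 hy0).map _, ?_, hchar⟩
  -- In an orthonormal basis the entries are traces of `b i * y * b j`, symmetric in `i` and `j`.
  ext i j
  rw [Matrix.transpose_apply, Algebra.leftMulMatrix_eq_repr_mul, Algebra.leftMulMatrix_eq_repr_mul,
    hb, hb, Algebra.traceForm_apply, Algebra.traceForm_apply]
  congr 1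
  ring

lemma exists_isFieldParam (hm : 0 < m) :
    ∃ B : Matrix (Fin m) (Fin m) (ZMod 2), IsFieldParam B := by
  obtain ⟨x, hx0, hdeg, hfib⟩ := exists_fibonacci_element hm
    (GaloisField.card 2 (2 * m) (by omega))
  obtain ⟨B, hB, hBs, hBc⟩ := exists_isSymm_charpoly hx0 hdeg
  exact ⟨B, hB, hBs, by rwa [hBc]⟩

end CyclicMUB

/-! ### Entanglement, local maps, and the stabilizer of the `Z` class -/

namespace CyclicMUB

variable {m : ℕ}

/-! ### Entanglement structures -/

lemma isSeparated_iff {K : Set (PVec m)} {S : Finset (Fin m)} :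
    IsSeparated K S ↔ ∀ a ∈ K, ∀ b ∈ K, sympl (restrictTo S a) (restrictTo S b) = 0 := by
  simp only [IsSeparated, pauli_commute_iff]

lemma sympl_eq_sum (a b : PVec m) :
    sympl a b = ∑ k, (a (Sum.inl k) * b (Sum.inr k) + a (Sum.inr k) * b (Sum.inl k)) := by
  simp only [sympl, dotProduct, zPart, xPart, Finset.sum_add_distrib]

lemma sympl_restrictTo (S : Finset (Fin m)) (a b : PVec m) :
    sympl (restrictTo S a) (restrictTo S b) =
      ∑ k ∈ S, (a (Sum.inl k) * b (Sum.inr k) + a (Sum.inr k) * b (Sum.inl k)) := by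
  rw [sympl_eq_sum, ← Finset.sum_filter_add_sum_filter_not Finset.univ (· ∈ S),
    Finset.filter_mem_eq_inter, Finset.univ_inter, add_eq_left.2]
  · refine Finset.sum_congr rfl fun k hk => ?_
    simp [restrictTo, hk]
  · refine Finset.sum_eq_zero fun k hk => ?_
    simp [restrictTo, (Finset.mem_filter.1 hk).2]

lemma sympl_restrictTo_left (S : Finset (Fin m)) (a b : PVec m) :
    sympl (restrictTo S a) b = sympl (restrictTo S a) (restrictTo S b) := by
  rw [sympl_eq_sum, sympl_eq_sum]
  refine Finset.sum_congr rfl fun k _ => ?_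
  by_cases hk : k ∈ S <;> simp [restrictTo, hk]

lemma restrictTo_inter (S T : Finset (Fin m)) (a : PVec m) :
    restrictTo (S ∩ T) a = restrictTo S (restrictTo T a) := by
  funext i
  simp only [restrictTo, Finset.mem_inter]
  split_ifs <;> simp_all

lemma restrictTo_compl (S : Finset (Fin m)) (a : PVec m) :
    restrictTo Sᶜ a = a + restrictTo S a := by
  funext i
  simp only [restrictTo, Finset.mem_compl, Pi.add_apply]
  split_ifs <;> simp_all [CharTwo.add_self_eq_zero]

/-- Subsystems that are unentangled with the rest split the operators of a maximal class. -/
lemma IsLagrangian.isSeparated_iff {K : Set (PVec m)} (hK : IsLagrangian K) {S : Finset (Fin m)} :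
    IsSeparated K S ↔ ∀ a ∈ K, restrictTo S a ∈ K := by
  rw [CyclicMUB.isSeparated_iff]
  refine forall₂_congr fun a _ => ?_
  rw [hK]
  refine forall₂_congr fun b _ => ?_
  rw [← sympl_restrictTo_left]

lemma IsLagrangian.isSeparated_inter {K : Set (PVec m)} (hK : IsLagrangian K)
    {S T : Finset (Fin m)} (hS : IsSeparated K S) (hT : IsSeparated K T) :
    IsSeparated K (S ∩ T) := by
  rw [hK.isSeparated_iff] at *
  intro a ha
  rw [restrictTo_inter]
  exact hS _ (hT a ha)

lemma IsLagrangian.isSeparated_compl {K : Set (PVec m)} (hK : IsLagrangian K)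
    {S : Finset (Fin m)} (hS : IsSeparated K S) : IsSeparated K Sᶜ := by
  rw [hK.isSeparated_iff] at *
  intro a ha
  rw [restrictTo_compl]
  exact hK.add_mem ha (hS a ha)

lemma IsLagrangian.isSeparated_univ {K : Set (PVec m)} (hK : IsLagrangian K) :
    IsSeparated K Finset.univ := by
  rw [hK.isSeparated_iff]
  intro a ha
  have : restrictTo Finset.univ a = a := by funext i; simp [restrictTo]
  rwa [this]

lemma entanglementType_congr {K L : Set (PVec m)} (h : ∀ S, IsSeparated K S ↔ IsSeparated L S) :
    entanglementType K = entanglementType L := by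
  have h1 : entanglementSetoid K = entanglementSetoid L := by
    ext i j
    change (∀ S, IsSeparated K S → (i ∈ S ↔ j ∈ S)) ↔ ∀ S, IsSeparated L S → (i ∈ S ↔ j ∈ S)
    simp only [h]
  have h2 : entanglementBlocks K = entanglementBlocks L := by
    unfold entanglementBlocks
    congr!
  unfold entanglementType
  simp only [h2]

lemma entanglementVector_congr {K L : Fin (2 ^ m + 1) → Set (PVec m)}
    (σ : Equiv.Perm (Fin (2 ^ m + 1)))
    (h : ∀ j, entanglementType (K j) = entanglementType (L (σ j))) :
    entanglementVector K = entanglementVector L := by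
  classical
  funext μ
  refine Finset.card_equiv σ fun j => ?_
  simp [h]

lemma entanglementType_eq_factorizable_iff {K : Set (PVec m)} :
    entanglementType K = factorizable m ↔ ∀ i j, entanglementSetoid K i j → i = j := by
  classical
  have hmem : ∀ i j, j ∈ (entanglementBlocks K).part i ↔ entanglementSetoid K i j := fun i j => by
    unfold entanglementBlocks
    exact Finpartition.mem_part_ofSetoid_iff_rel
  have hiff : entanglementType K = factorizable m ↔
      ∀ P ∈ (entanglementBlocks K).parts, P.card = 1 := by
    have hne : ∀ P ∈ (entanglementBlocks K).parts, P.card ≠ 0 := fun P hP =>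
      Finset.card_ne_zero.2 ((entanglementBlocks K).nonempty_of_mem_parts hP)
    have h1 : (entanglementType K).parts =
        (entanglementBlocks K).parts.val.map Finset.card := by
      refine (Nat.Partition.ofSums_parts m _ _).trans ?_
      refine Multiset.filter_eq_self.2 fun n hn => ?_
      obtain ⟨P, hP, rfl⟩ := Multiset.mem_map.1 hn
      exact hne P hP
    have h2 : (factorizable m).parts = Multiset.replicate m 1 := by
      rw [factorizable, Nat.Partition.ofSums_parts]
      refine Multiset.filter_eq_self.2 fun n hn => ?_
      rw [Multiset.eq_of_mem_replicate hn]
      exact one_ne_zero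
    rw [Nat.Partition.ext_iff, h1, h2, Multiset.eq_replicate]
    constructor
    · rintro ⟨-, h⟩ P hP
      exact h _ (Multiset.mem_map_of_mem _ hP)
    · intro h
      refine ⟨?_, fun n hn => ?_⟩
      · have := (entanglementBlocks K).sum_card_parts
        rw [Finset.sum_congr rfl h, Finset.sum_const, smul_eq_mul, mul_one, Finset.card_univ,
          Fintype.card_fin] at this
        rw [Multiset.card_map]
        exact this
      · obtain ⟨P, hP, rfl⟩ := Multiset.mem_map.1 hn
        exact h P hP
  rw [hiff]
  constructor
  · intro h i j hij
    obtain ⟨k, hk⟩ := Finset.card_eq_one.1 (h _ ((entanglementBlocks K).part_mem.2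
      (Finset.mem_univ i)))
    have hi := (hmem i i).2 ((entanglementSetoid K).refl i)
    have hj := (hmem i j).2 hij
    rw [hk, Finset.mem_singleton] at hi hj
    rw [hi, hj]
  · intro h P hP
    obtain ⟨i, hi⟩ := (entanglementBlocks K).nonempty_of_mem_parts hP
    refine Finset.card_eq_one.2 ⟨i, Finset.eq_singleton_iff_unique_mem.2 ⟨hi, fun j hj => ?_⟩⟩
    rw [← (entanglementBlocks K).part_eq_of_mem hP hi, hmem] at hj
    exact (h i j hj).symm

/-- In a completely factorizable class, each qubit is unentangled with the rest. -/
lemma IsLagrangian.isSeparated_singleton {K : Set (PVec m)} (hK : IsLagrangian K)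
    (h : entanglementType K = factorizable m) (k : Fin m) : IsSeparated K {k} := by
  rw [entanglementType_eq_factorizable_iff] at h
  -- Separated sets are closed under complement and intersection. For each `j ≠ k` one of them
  -- contains `k` but not `j`, and all of these intersect in `{k}`.
  have h1 : ∀ j, ∃ S, IsSeparated K S ∧ k ∈ S ∧ (j ∈ S → j = k) := by
    intro j
    by_cases hjk : j = k
    · exact ⟨Finset.univ, hK.isSeparated_univ, Finset.mem_univ k, fun _ => hjk⟩
    · have : ¬ ∀ S, IsSeparated K S → (k ∈ S ↔ j ∈ S) := fun hh => hjk (h k j hh).symm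
      push Not at this
      obtain ⟨S, hS, ⟨hk, hj⟩ | ⟨hk, hj⟩⟩ := this
      · exact ⟨S, hS, hk, fun hj' => absurd hj' hj⟩
      · exact ⟨Sᶜ, hK.isSeparated_compl hS, Finset.mem_compl.2 hk, fun hj' =>
          absurd hj (Finset.mem_compl.1 hj')⟩
  choose S hS hkS hjS using h1
  have h2 : ({k} : Finset (Fin m)) = Finset.univ.inf S := by
    ext j
    rw [Finset.mem_inf, Finset.mem_singleton]
    constructor
    · rintro rfl i _
      exact hkS i
    · intro hj
      exact hjS j (hj j (Finset.mem_univ j))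
  rw [h2]
  exact Finset.inf_induction hK.isSeparated_univ (fun _ h₁ _ h₂ => hK.isSeparated_inter h₁ h₂)
    fun j _ => hS j

/-! ### Local symplectic transformations -/

/-- The local transformation that maps the vector `u k` of each qubit to the `Z` type. -/
def localMap (u : PVec m) : PVec m →ₗ[ZMod 2] PVec m where
  toFun a := Sum.elim
    -- The `X` component is the symplectic pairing with `u` on the qubit. The `Z` component, the old
    -- `Z` or the old `X` entry according to `u`, completes it to a symplectic map when `u` is
    -- nonzero there.
    (fun k => u (Sum.inl k) * a (Sum.inl k) + (1 + u (Sum.inl k)) * a (Sum.inr k))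
    (fun k => u (Sum.inl k) * a (Sum.inr k) + u (Sum.inr k) * a (Sum.inl k))
  map_add' a b := by
    funext i
    rcases i with k | k <;> simp only [Sum.elim_inl, Sum.elim_inr, Pi.add_apply] <;> ring
  map_smul' c a := by
    funext i
    rcases i with k | k <;>
      simp only [Sum.elim_inl, Sum.elim_inr, Pi.smul_apply, smul_eq_mul, RingHom.id_apply] <;> ring

lemma localMap_inl (u a : PVec m) (k : Fin m) : localMap u a (Sum.inl k) =
    u (Sum.inl k) * a (Sum.inl k) + (1 + u (Sum.inl k)) * a (Sum.inr k) := rfl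

lemma localMap_inr (u a : PVec m) (k : Fin m) : localMap u a (Sum.inr k) =
    u (Sum.inl k) * a (Sum.inr k) + u (Sum.inr k) * a (Sum.inl k) := rfl

/-- The form is preserved on each qubit separately, a finite check over `F_2`; hence every subset
`S` keeps its separation property. -/
lemma sympl_restrictTo_localMap {u : PVec m} (hu : ∀ k, u (Sum.inl k) ≠ 0 ∨ u (Sum.inr k) ≠ 0)
    (S : Finset (Fin m)) (a b : PVec m) :
    sympl (restrictTo S (localMap u a)) (restrictTo S (localMap u b)) =
      sympl (restrictTo S a) (restrictTo S b) := by
  rw [sympl_restrictTo, sympl_restrictTo]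
  refine Finset.sum_congr rfl fun k _ => ?_
  have hk := hu k
  rw [localMap_inl, localMap_inl, localMap_inr, localMap_inr]
  generalize u (Sum.inl k) = p at *
  generalize u (Sum.inr k) = q at *
  generalize a (Sum.inl k) = x
  generalize a (Sum.inr k) = y
  generalize b (Sum.inl k) = z
  generalize b (Sum.inr k) = w
  revert p q x y z w
  decide

lemma sympl_localMap {u : PVec m} (hu : ∀ k, u (Sum.inl k) ≠ 0 ∨ u (Sum.inr k) ≠ 0)
    (a b : PVec m) : sympl (localMap u a) (localMap u b) = sympl a b := by
  have h : ∀ a : PVec m, restrictTo Finset.univ a = a := fun a => by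
    funext i; simp [restrictTo]
  have := sympl_restrictTo_localMap hu Finset.univ a b
  simpa only [h] using this

lemma entanglementType_localMap {u : PVec m} (hu : ∀ k, u (Sum.inl k) ≠ 0 ∨ u (Sum.inr k) ≠ 0)
    (K : Set (PVec m)) : entanglementType (localMap u '' K) = entanglementType K := by
  refine entanglementType_congr fun S => ?_
  simp only [isSeparated_iff, Set.forall_mem_image, sympl_restrictTo_localMap hu]

/-- Completely factorizable classes are locally equivalent to the class of `Z` type. -/
lemma IsLagrangian.exists_localMap {K : Set (PVec m)} (hK : IsLagrangian K)
    (h : entanglementType K = factorizable m) :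
    ∃ u : PVec m, (∀ k, u (Sum.inl k) ≠ 0 ∨ u (Sum.inr k) ≠ 0) ∧
      ∀ a ∈ K, ∀ k, localMap u a (Sum.inr k) = 0 := by
  have hex : ∀ k, ∃ w : ZMod 2 × ZMod 2, (w.1 ≠ 0 ∨ w.2 ≠ 0) ∧
      ∀ a ∈ K, w.1 * a (Sum.inr k) + w.2 * a (Sum.inl k) = 0 := by
    intro k
    by_cases hk : ∃ b ∈ K, b (Sum.inl k) ≠ 0 ∨ b (Sum.inr k) ≠ 0
    · obtain ⟨b, hb, hbk⟩ := hk
      -- As `{k}` is separated, all elements of `K` pair to zero on qubit `k` with the nonzero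
      -- restriction of `b`.
      refine ⟨(b (Sum.inl k), b (Sum.inr k)), hbk, fun a ha => ?_⟩
      have := CyclicMUB.isSeparated_iff.1 (hK.isSeparated_singleton h k) b hb a ha
      rwa [sympl_restrictTo, Finset.sum_singleton] at this
    · push Not at hk
      refine ⟨(1, 0), Or.inl one_ne_zero, fun a ha => ?_⟩
      rw [(hk a ha).1, (hk a ha).2]
      simp
  choose w hw0 hw using hex
  exact ⟨Sum.elim (fun k => (w k).1) (fun k => (w k).2), hw0, fun a ha k => hw k a ha⟩

lemma entanglementType_of_zType {K : Set (PVec m)} (h : ∀ a ∈ K, ∀ k, a (Sum.inr k) = 0) :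
    entanglementType K = factorizable m := by
  rw [entanglementType_eq_factorizable_iff]
  intro i j hij
  have hS : IsSeparated K {i} := by
    rw [isSeparated_iff]
    intro a ha b hb
    rw [sympl_restrictTo, Finset.sum_singleton, h a ha, h b hb]
    simp
  exact (Finset.mem_singleton.1 ((hij {i} hS).1 (Finset.mem_singleton_self i))).symm

/-! ### Symplectic transformations that preserve the class of `Z` type -/

/-- Preserving the `Z` class forces the lower left block to vanish. Symplecticity gives `Nᵀ W = 1`
and a symmetric `Yᵀ W` for the upper right block `Y`, so `A = Y Nᵀ` is symmetric and `Y = A W`. -/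
lemma exists_blocks_of_zType {f : PVec m →ₗ[ZMod 2] PVec m}
    (hf : ∀ a b, sympl (f a) (f b) = sympl a b) (hz : ∀ c k, f (zVec c) (Sum.inr k) = 0) :
    ∃ A N W : Matrix (Fin m) (Fin m) (ZMod 2), A.IsSymm ∧ Nᵀ * W = 1 ∧
      ∀ a, f a = Matrix.fromBlocks N (A * W) 0 W *ᵥ a := by
  have hz' : ∀ c : Fin m → ZMod 2, zPart (zVec c) = c ∧ xPart (zVec c) = 0 := fun c => ⟨rfl, rfl⟩
  set M : SMat m := LinearMap.toMatrix' f with hM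
  have hfM : ∀ a, f a = M *ᵥ a := fun a => (LinearMap.toMatrix'_mulVec f a).symm
  set N := M.toBlocks₁₁
  set Y := M.toBlocks₁₂
  set W := M.toBlocks₂₂
  have hL : M.toBlocks₂₁ = 0 := by
    ext k l
    have := hz (Pi.single l 1) k
    rw [hfM] at this
    simpa [Matrix.mulVec, dotProduct, Pi.single_apply, Matrix.toBlocks₂₁] using this
  have hMb : M = Matrix.fromBlocks N Y 0 W := by
    rw [← hL]; exact (Matrix.fromBlocks_toBlocks M).symm
  have hfz : ∀ x y, f (Sum.elim x y) = Sum.elim (N *ᵥ x + Y *ᵥ y) (W *ᵥ y) := by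
    intro x y
    rw [hfM, hMb, Matrix.fromBlocks_mulVec]
    simp
  have hsy : ∀ x y z w : Fin m → ZMod 2,
      sympl (Sum.elim x y) (Sum.elim z w) = x ⬝ᵥ w + y ⬝ᵥ z := fun _ _ _ _ => rfl
  have hNW : Nᵀ * W = 1 := by
    ext i j
    have := hf (Sum.elim (Pi.single i 1) 0) (Sum.elim 0 (Pi.single j 1))
    rw [hfz, hfz, hsy, hsy] at this
    simp only [Matrix.mulVec_zero, add_zero, zero_add, zero_dotProduct] at this
    rw [Matrix.mulVec_single_one, Matrix.mulVec_single_one, single_one_dotProduct,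
      Pi.single_apply] at this
    rw [Matrix.mul_apply, Matrix.one_apply]
    exact this
  have hYW : (Yᵀ * W).IsSymm := by
    ext i j
    have := hf (Sum.elim 0 (Pi.single i 1)) (Sum.elim 0 (Pi.single j 1))
    rw [hfz, hfz, hsy, hsy] at this
    simp only [Matrix.mulVec_zero, zero_add, zero_dotProduct, dotProduct_zero] at this
    rw [Matrix.mulVec_single_one, Matrix.mulVec_single_one, Matrix.mulVec_single_one,
      Matrix.mulVec_single_one] at this
    rw [Matrix.transpose_apply, Matrix.mul_apply, Matrix.mul_apply]
    have h1 := CharTwo.add_eq_zero.1 (this.trans (add_zero 0))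
    rw [dotProduct_comm (Matrix.col W i)] at h1
    exact h1.symm
  have hWN : W * Nᵀ = 1 := mul_eq_one_comm.1 hNW
  have hNWt : N * Wᵀ = 1 := by
    rw [← Matrix.transpose_transpose N, ← Matrix.transpose_mul, hWN, Matrix.transpose_one]
  refine ⟨Y * Nᵀ, N, W, ?_, hNW, fun a => ?_⟩
  · have h1 : Wᵀ * Y = Yᵀ * W := by
      have := hYW.eq
      rwa [Matrix.transpose_mul, Matrix.transpose_transpose] at this
    rw [Matrix.IsSymm, Matrix.transpose_mul, Matrix.transpose_transpose]
    calc N * Yᵀ = N * (Yᵀ * W) * Nᵀ := by rw [mul_assoc, mul_assoc, hWN, mul_one]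
      _ = Y * Nᵀ := by rw [← h1, ← mul_assoc, hNWt, one_mul]
  · rw [mul_assoc, hNW, mul_one, hfM, hMb]

end CyclicMUB

/-! ### Comparison of entanglement vectors -/

namespace CyclicMUB

variable {m : ℕ}

/-! ### The entanglement vectors of semigroup-based sets -/

lemma IsSemigroupParam.factorizable_pos {A R B : Matrix (Fin m) (Fin m) (ZMod 2)} :
    0 < entanglementVector (cyclicClasses (semigroupStabilizer A R B)) (factorizable m) := by
  classical
  refine Finset.card_pos.2 ⟨0, Finset.mem_filter.2 ⟨Finset.mem_univ _, ?_⟩⟩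
  refine entanglementType_of_zType fun a ha k => ?_
  obtain ⟨c, rfl⟩ := mem_cyclicClasses.1 ha
  simp

/-- Powers of a stabilizer matrix permute the classes cyclically. -/
lemma exists_perm_pow_image {C : SMat m} (hC : C ^ (2 ^ m + 1) = 1) (k : Fin (2 ^ m + 1)) :
    ∀ j, cyclicClasses C (k + j) = (C ^ (k : ℕ) *ᵥ ·) '' cyclicClasses C j := by
  intro j
  have h : C ^ ((k + j : Fin (2 ^ m + 1)) : ℕ) = C ^ (k : ℕ) * C ^ (j : ℕ) := by
    rw [Fin.val_add, ← pow_add]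
    conv_rhs => rw [← Nat.mod_add_div ((k : ℕ) + j) (2 ^ m + 1), pow_add, pow_mul, hC, one_pow,
      mul_one]
  ext a
  simp only [Set.mem_image, mem_cyclicClasses, exists_exists_eq_and, Matrix.mulVec_mulVec, h]

/-- A Pauli partition with a completely factorizable class that is equivalent to a field-based set
has the same entanglement vector as a semigroup-based set. -/
lemma exists_isSemigroupParam_entanglementVector {K : Fin (2 ^ m + 1) → Set (PVec m)}
    (hK : IsPauliPartition K) (hKf : IsEquivalentToFieldBased K)
    (hpos : 0 < entanglementVector K (factorizable m)) :
    ∃ A R B : Matrix (Fin m) (Fin m) (ZMod 2), IsSemigroupParam A R B ∧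
      entanglementVector (cyclicClasses (semigroupStabilizer A R B)) = entanglementVector K := by
  classical
  obtain ⟨B₀, hB₀, 𝓑₀, 𝓑, h𝓑₀, h𝓑, U, hU, π, V, hV, hVj⟩ := hKf
  rw [isEigenbasisFamily_iff] at h𝓑₀ h𝓑
  set C := fieldStabilizer B₀ with hC
  have hpart : IsPauliPartition (cyclicClasses C) := by
    rw [hC, ← semigroupStabilizer_zero_one]
    exact hB₀.isSemigroupParam.isPauliPartition
  have hCs : Implementable C := by
    rw [hC, ← semigroupStabilizer_zero_one]
    exact hB₀.isSemigroupParam.implementable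
  have hC1 : C ^ (2 ^ m + 1) = 1 := by
    rw [hC, ← semigroupStabilizer_zero_one]
    exact hB₀.isSemigroupParam.pow_eq_one
  have : Nontrivial (Fin (2 ^ m + 1)) :=
    Fin.nontrivial_iff_two_le.2 (Nat.succ_le_succ Nat.one_le_two_pow)
  obtain ⟨f, hf, hfK⟩ := exists_symplectic_of_isDiag (K := fun j => cyclicClasses C (π j)) (L := K)
    (fun j => hpart.isLagrangian _) hK.isLagrangian
    (fun a => by
      obtain ⟨j, hj⟩ := hpart.exists_mem a
      exact ⟨π.symm j, by simpa using hj⟩)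
    (fun i j hij a hi hj => hK.eq_zero_of_mem hij hi hj) hU (fun j => h𝓑₀ (π j)) h𝓑 hV hVj
  obtain ⟨j₀, hj₀⟩ := Finset.card_pos.1 hpos
  have hj₀ : entanglementType (K j₀) = factorizable m := (Finset.mem_filter.1 hj₀).2
  obtain ⟨u, hu, hu0⟩ := (hK.isLagrangian j₀).exists_localMap hj₀
  obtain ⟨UC, hUC, hUCC⟩ := hCs
  -- The power of `C` carries class `0` to class `π j₀`, `f` carries that to the factorizable class
  -- `K j₀`, and the local map turns it into `Z` type. So `F` preserves the `Z` class and is block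
  -- triangular.
  set F : PVec m →ₗ[ZMod 2] PVec m :=
    (localMap u).comp (f.comp (Matrix.mulVecLin (C ^ (π j₀ : ℕ)))) with hF
  have hFs : ∀ a b, sympl (F a) (F b) = sympl a b := fun a b => by
    change sympl (localMap u (f (C ^ (π j₀ : ℕ) *ᵥ a))) (localMap u (f (C ^ (π j₀ : ℕ) *ᵥ b))) = _
    rw [sympl_localMap hu, hf]
    exact (hUCC.pow _).sympl_mulVec (pow_mem hUC _) a b
  have himage : ∀ j, F '' cyclicClasses C j = localMap u '' K (π.symm (π j₀ + j)) := fun j => by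
    rw [hfK, Equiv.apply_symm_apply, exists_perm_pow_image hC1, Set.image_image, Set.image_image]
    rfl
  have hz : ∀ c k, F (zVec c) (Sum.inr k) = 0 := by
    intro c k
    have h1 : F (zVec c) ∈ F '' cyclicClasses C 0 :=
      ⟨_, mem_cyclicClasses.2 ⟨c, by simp⟩, rfl⟩
    rw [himage, add_zero, Equiv.symm_apply_apply] at h1
    obtain ⟨a, ha, hac⟩ := h1
    rw [← hac]
    exact hu0 a ha k
  obtain ⟨A, N, W, hA, hNW, hFM⟩ := exists_blocks_of_zType hFs hz
  have hWt : Wᵀ * N = 1 := by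
    rw [← Matrix.transpose_transpose N, ← Matrix.transpose_mul, hNW, Matrix.transpose_one]
  obtain ⟨hp, hcl⟩ := hB₀.conj hA hNW (B := N * B₀ * Wᵀ) (by rw [mul_assoc, hWt, mul_one])
  -- The semigroup-based classes are the images under `F` of the field-based ones, that is, local
  -- images of the classes of `K` reindexed by `j ↦ π⁻¹ (π j₀ + j)`.
  refine ⟨A, N * Nᵀ, N * B₀ * Wᵀ, hp,
    entanglementVector_congr ((Equiv.addLeft (π j₀)).trans π.symm) fun j => ?_⟩
  have hcl' : cyclicClasses (semigroupStabilizer A (N * Nᵀ) (N * B₀ * Wᵀ)) j =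
      F '' cyclicClasses C j := by
    rw [hcl]
    exact Set.image_congr fun a _ => (hFM a).symm
  rw [hcl', himage, entanglementType_localMap hu]
  rfl

lemma IsSemigroupParam.exists_isEigenbasisFamily (hm : 0 < m)
    {A R B : Matrix (Fin m) (Fin m) (ZMod 2)} (h : IsSemigroupParam A R B) :
    ∃ 𝓑, IsEigenbasisFamily (cyclicClasses (semigroupStabilizer A R B)) 𝓑 := by
  obtain ⟨U, hU, -, hUC⟩ := h.exists_unitary hm
  exact ⟨_, isEigenbasisFamily_pow hU hUC⟩

lemma IsSemigroupParam.mubEquivalent (hm : 0 < m) {A R B B₀ : Matrix (Fin m) (Fin m) (ZMod 2)}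
    (h : IsSemigroupParam A R B) (h₀ : IsFieldParam B₀) {𝓑 𝓑₀ : Fin (2 ^ m + 1) → QMat m}
    (h𝓑 : IsEigenbasisFamily (cyclicClasses (semigroupStabilizer A R B)) 𝓑)
    (h𝓑₀ : IsEigenbasisFamily (cyclicClasses (fieldStabilizer B₀)) 𝓑₀) : MUBEquivalent 𝓑₀ 𝓑 := by
  obtain ⟨M, hM, π, hπ⟩ := h.exists_implementable hm h₀
  exact mubEquivalent_of_image h.isPauliPartition.isLagrangian hM hπ h𝓑₀ h𝓑

lemma IsSemigroupParam.isEquivalentToFieldBased (hm : 0 < m)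
    {A R B : Matrix (Fin m) (Fin m) (ZMod 2)} (h : IsSemigroupParam A R B) :
    IsEquivalentToFieldBased (cyclicClasses (semigroupStabilizer A R B)) := by
  obtain ⟨B₀, h₀⟩ := exists_isFieldParam hm
  obtain ⟨𝓑₀, h𝓑₀⟩ := h₀.isSemigroupParam.exists_isEigenbasisFamily hm
  rw [semigroupStabilizer_zero_one] at h𝓑₀
  obtain ⟨𝓑, h𝓑⟩ := h.exists_isEigenbasisFamily hm
  exact ⟨B₀, h₀, 𝓑₀, 𝓑, h𝓑₀, h𝓑, h.mubEquivalent hm h₀ h𝓑 h𝓑₀⟩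

end CyclicMUB

theorem mainTheorem1 (m : ℕ) (hm : 0 < m) :
    -- admissible parameters exist, already with `A = 0` and `R = 1`
    (∃ B : Matrix (Fin m) (Fin m) (ZMod 2),
      CyclicMUB.IsFieldParam B ∧ CyclicMUB.IsSemigroupParam 0 1 B) ∧
    -- every admissible stabilizer matrix leads to a complete set of cyclic MUBs
    (∀ A R B : Matrix (Fin m) (Fin m) (ZMod 2), CyclicMUB.IsSemigroupParam A R B →
      CyclicMUB.IsPauliPartition
        (CyclicMUB.cyclicClasses (CyclicMUB.semigroupStabilizer A R B)) ∧
      (∃ U ∈ Matrix.unitaryGroup (Fin m → ZMod 2) ℂ,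
        U ^ (2 ^ m + 1) = 1 ∧
        CyclicMUB.Implements U (CyclicMUB.semigroupStabilizer A R B) ∧
        CyclicMUB.IsEigenbasisFamily
          (CyclicMUB.cyclicClasses (CyclicMUB.semigroupStabilizer A R B))
          (fun j => U ^ (j : ℕ)) ∧
        CyclicMUB.IsCyclicMUB (fun j : Fin (2 ^ m + 1) => U ^ (j : ℕ))) ∧
      (∀ 𝓑 : Fin (2 ^ m + 1) → CyclicMUB.QMat m,
        CyclicMUB.IsEigenbasisFamily
          (CyclicMUB.cyclicClasses (CyclicMUB.semigroupStabilizer A R B)) 𝓑 →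
        CyclicMUB.IsCompleteMUB 𝓑)) ∧
    -- these sets have exactly the entanglement structures of the sets with a completely
    -- factorizable basis that the scheme allows within the equivalence class
    (∀ n : Nat.Partition m → ℕ,
      (∃ A R B : Matrix (Fin m) (Fin m) (ZMod 2), CyclicMUB.IsSemigroupParam A R B ∧
        CyclicMUB.entanglementVector
          (CyclicMUB.cyclicClasses (CyclicMUB.semigroupStabilizer A R B)) = n) ↔
      (∃ K : Fin (2 ^ m + 1) → Set (CyclicMUB.PVec m), CyclicMUB.IsPauliPartition K ∧
        CyclicMUB.IsEquivalentToFieldBased K ∧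
        0 < CyclicMUB.entanglementVector K (CyclicMUB.factorizable m) ∧
        CyclicMUB.entanglementVector K = n)) ∧
    -- they are all equivalent to the field-based sets
    (∀ A R B B₀ : Matrix (Fin m) (Fin m) (ZMod 2), CyclicMUB.IsSemigroupParam A R B →
      CyclicMUB.IsFieldParam B₀ →
      ∀ 𝓑 𝓑₀ : Fin (2 ^ m + 1) → CyclicMUB.QMat m,
        CyclicMUB.IsEigenbasisFamily
          (CyclicMUB.cyclicClasses (CyclicMUB.semigroupStabilizer A R B)) 𝓑 →
        CyclicMUB.IsEigenbasisFamily
          (CyclicMUB.cyclicClasses (CyclicMUB.fieldStabilizer B₀)) 𝓑₀ →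
        CyclicMUB.MUBEquivalent 𝓑₀ 𝓑) := by
  refine ⟨?_, fun A R B h => ⟨h.isPauliPartition, ?_, fun 𝓑 h𝓑 => h.isPauliPartition.isCompleteMUB h𝓑⟩,
    fun n => ⟨?_, ?_⟩, fun A R B B₀ h h₀ 𝓑 𝓑₀ h𝓑 h𝓑₀ => h.mubEquivalent hm h₀ h𝓑 h𝓑₀⟩
  · obtain ⟨B, hB⟩ := CyclicMUB.exists_isFieldParam hm
    exact ⟨B, hB, hB.isSemigroupParam⟩
  · obtain ⟨U, hU, hU1, hUC⟩ := h.exists_unitary hm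
    have hE := CyclicMUB.isEigenbasisFamily_pow hU hUC
    exact ⟨U, hU, hU1, hUC, hE,
      CyclicMUB.isCyclicMUB_pow hU hU1 (h.isPauliPartition.isCompleteMUB hE)⟩
  · rintro ⟨A, R, B, h, rfl⟩
    exact ⟨_, h.isPauliPartition, h.isEquivalentToFieldBased hm,
      CyclicMUB.IsSemigroupParam.factorizable_pos, rfl⟩
  · rintro ⟨K, hK, hKf, hpos, rfl⟩
    exact CyclicMUB.exists_isSemigroupParam_entanglementVector hK hKf hpos
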